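/- For $g\in L_2(\mathbb R)$ let $\mathcal F[g]\in L_2(\mathbb R)$ denote its Fourier transform, normalized so that $\mathcal F[g](u)=\int_{-\infty}^{\infty}g(t)e^{-iut}\,dt$ for $g\in L_1(\mathbb R)\cap L_2(\mathbb R)$. Let $PW_\pi$ be the space of all $g\in L_2(\mathbb R)$ such that $\mathcal F[g]=0$ almost everywhere outside $[-\pi,\pi]$; every such $g$ is represented by its continuous version. A sequence $(\varphi_j)_{j\in\mathbb Z}$ in a Hilbert space $\mathcal H$ is a Riesz basis of $\mathcal H$ if every $h\in\mathcal H$ has a unique representation $h=\sum_{j}a_j\varphi_j$ with $\sum_j|a_j|^2<\infty$, and there is a constant $B>0$ with $B^{-1}(\sum_j|c_j|^2)^{1/2}\le\|\sum_jc_j\varphi_j\|\le B(\sum_j|c_j|^2)^{1/2}$ for every square-summable $(c_j)_{j\in\mathbb Z}$. A real sequence $(x_j)_{j\in\mathbb Z}$ is a Riesz-basis sequence if $x_j<x_{j+1}$ for all $j$ and the functions $t\mapsto e^{-ix_jt}$, $j\in\mathbb Z$, form a Riesz basis of $L_2[-\pi,\pi]$. **Theorem.** Let $(x_j)_{j\in\mathbb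 Z}$ be a Riesz-basis sequence and let $f\in PW_\pi$. For every $\lambda>0$ there is a unique square-summable sequence $(a_j)_{j\in\mathbb Z}$ of complex numbers, depending on $\lambda$, $f$ and $(x_j)$, such that $\sum_{j}a_je^{-\lambda(x_k-x_j)^2}=f(x_k)$ for all $k\in\mathbb Z$; the Gaussian interpolant $$I_\lambda(f)(t):=\sum_{j\in\mathbb Z}a_je^{-\lambda(t-x_j)^2},\qquad t\in\mathbb R,$$ is well defined (the series converges for every $t$), is continuous and square integrable on $\mathbb R$, and satisfies $I_\lambda(f)(x_k)=f(x_k)$ for all $k\in\mathbb Z$. Moreover, $$\lim_{\lambda\to0^+}\|f-I_\lambda(f)\|_{L_2(\mathbb R)}=0,$$ and $I_\lambda(f)\to f$ uniformly on $\mathbb R$ as $\lambda\to0^+$. -/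

import Mathlib

open MeasureTheory Filter Topology

noncomputable section

/-- A family `φ` indexed by `ℤ` is a Riesz basis of the complex Hilbert space `H`: every `h` has a
unique representation `h = ∑ j, a j • φ j` with square-summable coefficients, and for every
square-summable `c` the series `∑ j, c j • φ j` has a norm comparable to the `ℓ²` norm of `c`. -/
structure IsRieszBasis {H : Type*} [NormedAddCommGroup H] [InnerProductSpace ℂ H]
    (φ : ℤ → H) : Prop where
  existsUnique_repr : ∀ h : H, ∃! a : ℤ → ℂ,
    Summable (fun j => ‖a j‖ ^ 2) ∧ HasSum (fun j => a j • φ j) h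
  exists_bound : ∃ B : ℝ, 0 < B ∧ ∀ c : ℤ → ℂ, Summable (fun j => ‖c j‖ ^ 2) →
    Summable (fun j => c j • φ j) ∧
    B⁻¹ * Real.sqrt (∑' j, ‖c j‖ ^ 2) ≤ ‖∑' j, c j • φ j‖ ∧
    ‖∑' j, c j • φ j‖ ≤ B * Real.sqrt (∑' j, ‖c j‖ ^ 2)

/-- Lebesgue measure on `[-π, π]`. -/
abbrev bandMeasure : Measure ℝ := volume.restrict (Set.Icc (-Real.pi) Real.pi)

theorem memLp_exponential (x : ℝ) :
    MemLp (fun t : ℝ => Complex.exp (-(Complex.I * x * t))) 2 bandMeasure := by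
  refine MemLp.of_bound (Continuous.aestronglyMeasurable (by fun_prop)) 1 ?_
  refine Filter.Eventually.of_forall fun t => ?_
  rw [show -(Complex.I * (x : ℂ) * (t : ℂ)) = ((-(x * t) : ℝ) : ℂ) * Complex.I by push_cast; ring,
    Complex.norm_exp_ofReal_mul_I]

/-- The exponential `t ↦ e^{-ixt}` as an element of `L²[-π, π]`. -/
def exponential (x : ℝ) : Lp ℂ 2 bandMeasure := (memLp_exponential x).toLp _

/-- A Riesz-basis sequence: a strictly increasing real sequence `(x_j)` indexed by `ℤ` such that
the exponentials `t ↦ e^{-i x_j t}` form a Riesz basis of `L²[-π, π]`. -/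
structure IsRieszBasisSequence (x : ℤ → ℝ) : Prop where
  lt_succ : ∀ j, x j < x (j + 1)
  rieszBasis : IsRieszBasis (fun j => exponential (x j))

/-- The Fourier transform on `L²(ℝ)` in the normalization `∫ g(t) e^{-iut} dt`, as a function of
the angular frequency `u` (determined up to a null set). Mathlib's `𝓕` uses `e^{-2πiξt}`, so that
`u = 2πξ`. -/
def fourierL2 (g : Lp ℂ 2 (volume : Measure ℝ)) : ℝ → ℂ :=
  fun u => (FourierTransform.fourier g : Lp ℂ 2 (volume : Measure ℝ)) (u / (2 * Real.pi))

/-- The Paley–Wiener space `PW_π`: square-integrable functions whose Fourier transform vanishes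
almost everywhere outside `[-π, π]`; each is represented by its continuous version. -/
def paleyWiener : Set (ℝ → ℂ) :=
  {f | Continuous f ∧ ∃ hf : MemLp f 2 volume,
    ∀ᵐ u : ℝ, u ∉ Set.Icc (-Real.pi) Real.pi → fourierL2 (hf.toLp f) u = 0}

/-- The Gaussian `g_λ(t) = e^{-λ t²}`, complex-valued. -/
def gaussian (lam t : ℝ) : ℂ := (Real.exp (-lam * t ^ 2) : ℂ)

/-- `a` is a square-summable solution of the Gaussian interpolation equations
`∑ j, a_j e^{-λ (x_k - x_j)²} = f(x_k)`, for all integers `k`. -/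
def IsGaussianCoeff (lam : ℝ) (x : ℤ → ℝ) (f : ℝ → ℂ) (a : ℤ → ℂ) : Prop :=
  Summable (fun j => ‖a j‖ ^ 2) ∧
    ∀ k, HasSum (fun j => a j * gaussian lam (x k - x j)) (f (x k))

/-- The coefficients of the Gaussian interpolant (meaningful when the interpolation equations have
a unique square-summable solution). -/
def gaussianCoeff (lam : ℝ) (x : ℤ → ℝ) (f : ℝ → ℂ) : ℤ → ℂ :=
  Classical.epsilon (IsGaussianCoeff lam x f)

/-- The Gaussian interpolant `I_λ(f)(t) = ∑ j, a_j e^{-λ (t - x_j)²}`. -/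
def gaussianInterpolant (lam : ℝ) (x : ℤ → ℝ) (f : ℝ → ℂ) (t : ℝ) : ℂ :=
  ∑' j, gaussianCoeff lam x f j * gaussian lam (t - x j)

end

/-! Write `w(u) = e^{(π² - u²)/(4λ)}` and `e_t(u) = e^{-itu}`. Since the transform of a Gaussian is
a Gaussian, `e^{-λ(t-s)²}` is, up to the constant `weightMass`, the inner product of `e_t` and `e_s`
in `L²(w du)`. If `f` has spectrum `F` supported in the band, then `2π f(t)` is the weighted inner
product of `e_t` with `F/w`. Hence the interpolation equations are the normal equations of the
synthesis operator `S c = ∑ c_j e_{x_j}` (`isGaussianCoeff_iff`): a rescaled solution gives `h`, the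
orthogonal projection of `F/w` onto the range of `S`, and the interpolant has spectrum `w h`. As `w
≥ 1` on the band, `S` inherits the lower Riesz bound, which yields unique solvability.

For the limit, `‖h‖_w ≤ ‖F/w‖_w = (∫ |F|²/w)^{1/2}`, which tends to `0` by dominated convergence
because `w → ∞` inside the band (`tendsto_eLpNorm_weightDiv`). It remains to bound `F - w h` by a
multiple of `‖h‖_w`, uniformly for `λ ≤ 1`. Off the band this follows from `w ≤ 1`. On the band,
with `T` the unweighted synthesis operator, the normal equations turn `⟨T d, F - w h⟩` into the part
of `⟨S d, h⟩_w` off the band (`norm_sub_weightMul_le`). Since `T` is onto, `T d` may be the error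
itself, so a Bessel bound for `S` off the band suffices. That bound is uniform: a shift by `2πl`
only changes the phases of the coefficients, so all blocks of length `2π` share one Bessel constant,
and `w` is summable over the blocks.

Finally the `L²` bound on `F - w h` gives `L²` convergence by Plancherel, and the `L¹` bound gives
uniform convergence. -/

noncomputable section

/-! ### The inverse Fourier integral on `L¹ ∩ L²` -/

-- Both sides agree against smooth compactly supported test functions: the `L²` inverse transform is
-- compatible with the distributional one, and Fubini moves the inverse integral onto the test
-- function.
open scoped FourierTransform SchwartzMap in
theorem fourierInv_toLp_ae_eq {G : ℝ → ℂ} (hG1 : Integrable G) (hG2 : MemLp G 2 volume) :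
    (FourierTransform.fourierInv (hG2.toLp G) : Lp ℂ 2 (volume : Measure ℝ)) =ᵐ[volume]
      (𝓕⁻ G : ℝ → ℂ) := by
  have hcont : Continuous (𝓕⁻ G : ℝ → ℂ) :=
    VectorFourier.fourierIntegral_continuous Real.continuous_fourierChar
      (L := -innerₗ ℝ) continuous_inner.neg hG1
  refine ae_eq_of_integral_contDiff_smul_eq ((Lp.memLp _).locallyIntegrable (by norm_num))
    hcont.locallyIntegrable fun g g_smooth g_cpt => ?_
  have hg₁ : HasCompactSupport (Complex.ofRealCLM ∘ g) := g_cpt.comp_left rfl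
  have hg₂ : ContDiff ℝ ((⊤ : ℕ∞) : WithTop ℕ∞) (Complex.ofRealCLM ∘ g) := by fun_prop
  set φ : 𝓢(ℝ, ℂ) := hg₁.toSchwartzMap hg₂ with hφ
  have hφg : ∀ x, φ x = (g x : ℂ) := fun x => rfl
  have e1 : ∀ u : ℝ → ℂ, ∫ x, g x • u x = ∫ x, φ x • u x := fun u => by
    refine integral_congr_ae (.of_forall fun x => ?_)
    simp [hφg]
  have h := DFunLike.congr_fun (Lp.fourierInv_toTemperedDistribution_eq (hG2.toLp G)) φ
  rw [TemperedDistribution.fourierInv_apply, Lp.toTemperedDistribution_apply,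
    Lp.toTemperedDistribution_apply] at h
  rw [e1, e1, ← h]
  have h2 := VectorFourier.integral_fourierIntegral_smul_eq_flip (μ := volume) (ν := volume)
    (L := -innerₗ ℝ) Real.continuous_fourierChar continuous_inner.neg (φ.integrable) hG1
  have hflip : (-innerₗ ℝ : ℝ →ₗ[ℝ] ℝ →ₗ[ℝ] ℝ).flip = -innerₗ ℝ := by
    ext; simp
  rw [hflip] at h2
  refine (integral_congr_ae ?_).trans h2
  filter_upwards [hG2.coeFn_toLp] with x hx
  rw [hx, SchwartzMap.fourierInv_coe]
  rfl

/-- The inverse Fourier integral in the angular normalization `(2π)⁻¹ ∫ e^{itu} D(u) du`. -/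
def angularFourierInv (D : ℝ → ℂ) (t : ℝ) : ℂ :=
  (2 * Real.pi : ℂ)⁻¹ * ∫ u : ℝ, Complex.exp (Complex.I * t * u) * D u

open scoped FourierTransform in
theorem angularFourierInv_eq_fourierInv (D : ℝ → ℂ) :
    angularFourierInv D = 𝓕⁻ (fun ξ : ℝ => D (2 * Real.pi * ξ)) := by
  ext t
  have hpi := Real.pi_pos
  have h := Measure.integral_comp_mul_left
    (fun u : ℝ => Complex.exp (Complex.I * t * u) * D u) (2 * Real.pi)
  rw [Real.fourierInv_eq', angularFourierInv]
  rw [abs_of_pos (by positivity), Complex.real_smul] at h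
  push_cast at h
  rw [← h]
  refine integral_congr_ae (.of_forall fun ξ => ?_)
  simp only [smul_eq_mul, RCLike.inner_apply, conj_trivial]
  congr 2
  push_cast
  ring

/-- Because `2π ≥ 1`, the change of frequency variable only decreases norms. Inequalities suffice
for every limit below, so the exact powers of `2π` are not tracked. -/
theorem map_mul_two_pi_le : Measure.map (fun ξ : ℝ => 2 * Real.pi * ξ) volume ≤ volume := by
  have hpi := Real.two_le_pi
  rw [Real.map_volume_mul_left (by positivity)]
  intro s
  rw [Measure.smul_apply, smul_eq_mul]
  refine mul_le_of_le_one_left zero_le ?_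
  rw [ENNReal.ofReal_le_one, abs_of_pos (by positivity)]
  exact inv_le_one_of_one_le₀ (by linarith)

theorem eLpNorm_comp_mul_two_pi_le {D : ℝ → ℂ} {p : ENNReal}
    (hD : AEStronglyMeasurable D volume) :
    eLpNorm (fun ξ : ℝ => D (2 * Real.pi * ξ)) p volume ≤ eLpNorm D p volume := by
  have := eLpNorm_map_measure (p := p) (hD.mono_measure map_mul_two_pi_le)
    (measurable_const_mul (2 * Real.pi)).aemeasurable
  exact this.symm.trans_le (eLpNorm_mono_measure D map_mul_two_pi_le)

theorem MemLp.comp_mul_two_pi {D : ℝ → ℂ} {p : ENNReal} (hD : MemLp D p volume) :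
    MemLp (fun ξ : ℝ => D (2 * Real.pi * ξ)) p volume :=
  ⟨(hD.1.mono_measure map_mul_two_pi_le).comp_measurable (measurable_const_mul (2 * Real.pi)),
    (eLpNorm_comp_mul_two_pi_le hD.1).trans_lt hD.2⟩

theorem continuous_angularFourierInv {D : ℝ → ℂ} (hD : Integrable D) :
    Continuous (angularFourierInv D) := by
  rw [angularFourierInv_eq_fourierInv]
  exact VectorFourier.fourierIntegral_continuous Real.continuous_fourierChar
      (L := -innerₗ ℝ) continuous_inner.neg
      (memLp_one_iff_integrable.1 (MemLp.comp_mul_two_pi (memLp_one_iff_integrable.2 hD)))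

/-- Plancherel, with the factor `(2π)^{-1/2}` discarded. -/
theorem eLpNorm_angularFourierInv_le {D : ℝ → ℂ} (hD1 : Integrable D) (hD2 : MemLp D 2 volume) :
    eLpNorm (angularFourierInv D) 2 volume ≤ eLpNorm D 2 volume := by
  have h1 := memLp_one_iff_integrable.1 (MemLp.comp_mul_two_pi (memLp_one_iff_integrable.2 hD1))
  have h2 := MemLp.comp_mul_two_pi hD2
  rw [angularFourierInv_eq_fourierInv, ← eLpNorm_congr_ae (fourierInv_toLp_ae_eq h1 h2)]
  refine le_trans (le_of_eq ?_) (eLpNorm_comp_mul_two_pi_le hD2.1)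
  have h3 := (Lp.fourierTransformₗᵢ ℝ ℂ).symm.norm_map (h2.toLp _)
  have h4 : eLpNorm ((Lp.fourierTransformₗᵢ ℝ ℂ).symm (h2.toLp _) : Lp ℂ 2 (volume : Measure ℝ))
      2 volume = eLpNorm (h2.toLp _ : Lp ℂ 2 (volume : Measure ℝ)) 2 volume := by
    rw [← Lp.enorm_def, ← Lp.enorm_def, ← ofReal_norm, ← ofReal_norm, h3]
  exact h4.trans (eLpNorm_congr_ae h2.coeFn_toLp)

theorem norm_angularFourierInv_le (D : ℝ → ℂ) (t : ℝ) :
    ‖angularFourierInv D t‖ ≤ ∫ u, ‖D u‖ := by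
  have hpi := Real.two_le_pi
  rw [angularFourierInv, norm_mul]
  have h1 : ‖(2 * Real.pi : ℂ)⁻¹‖ ≤ 1 := by
    rw [norm_inv, norm_mul, Complex.norm_real, Real.norm_of_nonneg (by positivity)]
    refine inv_le_one_of_one_le₀ ?_
    norm_num
    linarith
  refine (mul_le_of_le_one_left (norm_nonneg _) h1).trans ?_
  refine (norm_integral_le_integral_norm _).trans_eq ?_
  refine integral_congr_ae (.of_forall fun u => ?_)
  simp only [norm_mul]
  rw [show Complex.I * (t : ℂ) * (u : ℂ) = ((t * u : ℝ) : ℂ) * Complex.I by push_cast; ring,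
    Complex.norm_exp_ofReal_mul_I, one_mul]

/-! ### Spectra of Paley–Wiener functions -/

theorem integrable_of_memLp_two_of_eq_zero {F : ℝ → ℂ} (hF : MemLp F 2 volume)
    (h0 : ∀ u ∉ Set.Icc (-Real.pi) Real.pi, F u = 0) : Integrable F := by
  have h1 : MemLp F 2 bandMeasure := hF.mono_measure Measure.restrict_le_self
  have h2 : IntegrableOn F (Set.Icc (-Real.pi) Real.pi) volume :=
    memLp_one_iff_integrable.1 (h1.mono_exponent (by norm_num))
  exact (integrableOn_iff_integrable_of_support_subset fun u hu => by
    by_contra h; exact hu (h0 u h)).1 h2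

/-- A function in the Paley–Wiener space is the inverse Fourier integral of a square-integrable
function supported in the band. -/
theorem exists_spectrum_of_mem_paleyWiener {f : ℝ → ℂ} (hf : f ∈ paleyWiener) :
    ∃ F : ℝ → ℂ, MemLp F 2 volume ∧ (∀ u ∉ Set.Icc (-Real.pi) Real.pi, F u = 0) ∧
      f = angularFourierInv F := by
  obtain ⟨hfc, hfL, hband⟩ := hf
  have hpi := Real.pi_pos
  set g : Lp ℂ 2 (volume : Measure ℝ) := FourierTransform.fourier (hfL.toLp f) with hg
  -- Truncating alters the transform only on a null set, and makes it vanish everywhere, not just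
  -- almost everywhere, off the band.
  set F : ℝ → ℂ := (Set.Icc (-Real.pi) Real.pi).indicator (fourierL2 (hfL.toLp f)) with hFdef
  have hF0 : ∀ u ∉ Set.Icc (-Real.pi) Real.pi, F u = 0 := fun u hu =>
    Set.indicator_of_notMem hu _
  have hFae : F =ᵐ[volume] fourierL2 (hfL.toLp f) := by
    filter_upwards [hband] with u hu
    by_cases h : u ∈ Set.Icc (-Real.pi) Real.pi
    · exact Set.indicator_of_mem h _
    · rw [hF0 u h, hu h]
  have hqmp : Measure.QuasiMeasurePreserving (fun ξ : ℝ => 2 * Real.pi * ξ) volume volume :=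
    ⟨measurable_const_mul _, map_mul_two_pi_le.absolutelyContinuous⟩
  have hGg : (fun ξ : ℝ => F (2 * Real.pi * ξ)) =ᵐ[volume] g := by
    have := hqmp.ae_eq_comp hFae
    filter_upwards [this] with ξ hξ
    have : F (2 * Real.pi * ξ) = g (2 * Real.pi * ξ / (2 * Real.pi)) := hξ
    rw [this, mul_div_cancel_left₀ _ (by positivity)]
  have hFL : MemLp F 2 volume := by
    refine MemLp.ae_eq hFae.symm ?_
    have h1 : MemLp (g : ℝ → ℂ) 2 (Measure.map (fun u : ℝ => (2 * Real.pi)⁻¹ * u) volume) := by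
      rw [Real.map_volume_mul_left (by positivity)]
      exact (Lp.memLp g).smul_measure ENNReal.ofReal_ne_top
    have h2 := h1.comp_of_map (measurable_const_mul _).aemeasurable
    refine h2.ae_eq (.of_forall fun u => ?_)
    simp only [Function.comp, fourierL2, ← hg, div_eq_inv_mul]
  have hF1 := integrable_of_memLp_two_of_eq_zero hFL hF0
  refine ⟨F, hFL, hF0, ?_⟩
  refine (Continuous.ae_eq_iff_eq volume hfc (continuous_angularFourierInv hF1)).1 ?_
  have h1 := memLp_one_iff_integrable.1 (MemLp.comp_mul_two_pi (memLp_one_iff_integrable.2 hF1))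
  have h2 := MemLp.comp_mul_two_pi hFL
  rw [angularFourierInv_eq_fourierInv]
  refine EventuallyEq.trans ?_ (fourierInv_toLp_ae_eq h1 h2)
  have h3 : h2.toLp _ = g := Lp.ext (h2.coeFn_toLp.trans hGg)
  rw [h3, hg, FourierTransform.fourierInv_fourier_eq]
  exact hfL.coeFn_toLp.symm

/-! ### Synthesis operators on `ℓ²` -/

theorem memℓp_two_iff {c : ℤ → ℂ} : Memℓp c 2 ↔ Summable fun j => ‖c j‖ ^ 2 := by
  rw [memℓp_gen_iff (by norm_num)]
  norm_num

theorem lp_norm_sq (c : lp (fun _ : ℤ => ℂ) 2) : ‖c‖ ^ 2 = ∑' j, ‖c j‖ ^ 2 := by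
  have := lp.norm_rpow_eq_tsum (p := 2) (by norm_num) c
  norm_num at this
  exact this

theorem lp_summable_sq (c : lp (fun _ : ℤ => ℂ) 2) : Summable fun j => ‖c j‖ ^ 2 :=
  memℓp_two_iff.1 (lp.memℓp c)

section Synthesis

variable {H : Type*} [NormedAddCommGroup H] [InnerProductSpace ℂ H]

/-- A family satisfying a Bessel bound on finite sums has a bounded synthesis operator. -/
theorem exists_synthesis [CompleteSpace H] {φ : ℤ → H} {K : ℝ} (hK : 0 ≤ K)
    (h : ∀ (s : Finset ℤ) (c : ℤ → ℂ), ‖∑ j ∈ s, c j • φ j‖ ^ 2 ≤ K * ∑ j ∈ s, ‖c j‖ ^ 2) :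
    ∃ S : lp (fun _ : ℤ => ℂ) 2 →L[ℂ] H, (∀ c, HasSum (fun j => c j • φ j) (S c)) ∧
      ∀ c, ‖S c‖ ^ 2 ≤ K * ‖c‖ ^ 2 := by
  have hsum : ∀ c : lp (fun _ : ℤ => ℂ) 2, Summable fun j => c j • φ j := by
    intro c
    rw [summable_iff_vanishing_norm]
    intro ε hε
    have hc := lp_summable_sq c
    rw [summable_iff_vanishing_norm] at hc
    -- `K + 1` in place of `K` allows `K = 0`.
    obtain ⟨s, hs⟩ := hc (ε ^ 2 / (K + 1)) (by positivity)
    refine ⟨s, fun t ht => ?_⟩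
    have h1 := hs t ht
    rw [Real.norm_of_nonneg (Finset.sum_nonneg fun _ _ => by positivity)] at h1
    have h2 := h t c
    refine lt_of_pow_lt_pow_left₀ 2 hε.le (h2.trans_lt ?_)
    have h4 : 0 ≤ ∑ j ∈ t, ‖c j‖ ^ 2 := Finset.sum_nonneg fun _ _ => by positivity
    rw [lt_div_iff₀ (by positivity)] at h1
    nlinarith
  have hbound : ∀ c : lp (fun _ : ℤ => ℂ) 2, ‖∑' j, c j • φ j‖ ^ 2 ≤ K * ‖c‖ ^ 2 := by
    intro c
    refine le_of_tendsto_of_tendsto' ((hsum c).hasSum.norm.pow 2) ?_ fun s => h s c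
    rw [lp_norm_sq]
    exact (lp_summable_sq c).hasSum.const_mul K |>.congr fun s => by rw [Finset.mul_sum]
  let S₀ : lp (fun _ : ℤ => ℂ) 2 →ₗ[ℂ] H :=
    { toFun := fun c => ∑' j, c j • φ j
      map_add' := fun c d => by
        rw [← (hsum c).tsum_add (hsum d)]
        simp [add_smul]
      map_smul' := fun a c => by
        rw [RingHom.id_apply, ← (hsum c).tsum_const_smul]
        simp [mul_smul] }
  refine ⟨S₀.mkContinuous (Real.sqrt K) fun c => ?_, fun c => (hsum c).hasSum, hbound⟩
  refine (sq_le_sq₀ (norm_nonneg _) (by positivity)).1 ?_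
  rw [mul_pow, Real.sq_sqrt hK]
  exact hbound c

/-- The synthesis operator of a Riesz basis is bounded, bounded below and onto. -/
theorem IsRieszBasis.exists_synthesis [CompleteSpace H] {φ : ℤ → H} (hφ : IsRieszBasis φ) :
    ∃ (B : ℝ) (T : lp (fun _ : ℤ => ℂ) 2 →L[ℂ] H), 0 < B ∧
      (∀ (s : Finset ℤ) (c : ℤ → ℂ), ‖∑ j ∈ s, c j • φ j‖ ^ 2 ≤ B ^ 2 * ∑ j ∈ s, ‖c j‖ ^ 2) ∧
      (∀ c, HasSum (fun j => c j • φ j) (T c)) ∧ Function.Surjective T ∧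
      ∀ c, ‖c‖ ≤ B * ‖T c‖ := by
  obtain ⟨B, hB, hb⟩ := hφ.exists_bound
  have hfin : ∀ (s : Finset ℤ) (c : ℤ → ℂ),
      ‖∑ j ∈ s, c j • φ j‖ ^ 2 ≤ B ^ 2 * ∑ j ∈ s, ‖c j‖ ^ 2 := by
    intro s c
    -- Extension by zero lets the bound for infinite series be applied to a finite sum.
    set d : ℤ → ℂ := fun j => if j ∈ s then c j else 0 with hd
    have h1 : ∀ j ∉ s, ‖d j‖ ^ 2 = 0 := fun j hj => by simp [hd, hj]
    have h2 : ∀ j ∉ s, d j • φ j = 0 := fun j hj => by simp [hd, hj]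
    have h3 : ∑' j, d j • φ j = ∑ j ∈ s, c j • φ j := by
      rw [tsum_eq_sum h2]
      exact Finset.sum_congr rfl fun j hj => by simp [hd, hj]
    have h4 : ∑' j, ‖d j‖ ^ 2 = ∑ j ∈ s, ‖c j‖ ^ 2 := by
      rw [tsum_eq_sum h1]
      exact Finset.sum_congr rfl fun j hj => by simp [hd, hj]
    obtain ⟨-, -, h5⟩ := hb d (summable_of_ne_finset_zero h1)
    rw [h3, h4] at h5
    have h6 := pow_le_pow_left₀ (norm_nonneg _) h5 2
    rwa [mul_pow, Real.sq_sqrt (Finset.sum_nonneg fun _ _ => by positivity)] at h6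
  obtain ⟨T, hT, -⟩ := _root_.exists_synthesis (sq_nonneg B) hfin
  refine ⟨B, T, hB, hfin, hT, fun h => ?_, fun c => ?_⟩
  · obtain ⟨a, ⟨ha, hs⟩, -⟩ := hφ.existsUnique_repr h
    exact ⟨⟨a, memℓp_two_iff.2 ha⟩, (hT _).unique hs⟩
  · obtain ⟨-, h1, -⟩ := hb c (lp_summable_sq c)
    rw [(hT c).tsum_eq, ← lp_norm_sq, Real.sqrt_sq (norm_nonneg _)] at h1
    rwa [inv_mul_le_iff₀ hB] at h1

theorem synthesis_single {φ : ℤ → H} {S : lp (fun _ : ℤ => ℂ) 2 →L[ℂ] H}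
    (hS : ∀ c, HasSum (fun j => c j • φ j) (S c)) (k : ℤ) : S (lp.single 2 k 1) = φ k := by
  refine (hS _).unique ?_
  have := hasSum_single (f := fun j => (lp.single 2 k (1 : ℂ) : lp (fun _ : ℤ => ℂ) 2) j • φ j) k
    fun j hj => by simp [hj]
  simpa using this

/-- Pairing is continuous, so equations tested on the individual `φ k` extend to the whole range of
`S`. This turns the pointwise interpolation conditions into normal equations. -/
theorem inner_synthesis_congr {φ : ℤ → H} {S : lp (fun _ : ℤ => ℂ) 2 →L[ℂ] H}
    (hS : ∀ c, HasSum (fun j => c j • φ j) (S c)) {v w : H}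
    (h : ∀ k, inner ℂ (φ k) v = inner ℂ (φ k) w) (d : lp (fun _ : ℤ => ℂ) 2) :
    inner ℂ (S d) v = inner ℂ (S d) w := by
  have key : ∀ z : H, HasSum (fun j => (starRingEnd ℂ) (d j) * inner ℂ (φ j) z)
      (inner ℂ (S d) z) := by
    intro z
    have h1 : HasSum (fun j => inner ℂ z (d j • φ j)) (inner ℂ z (S d)) :=
      (hS d).mapL (innerSL ℂ z)
    have h2 := h1.map (starRingEnd ℂ) RCLike.continuous_conj
    simpa [Function.comp_def, inner_smul_right] using h2
  refine (key v).unique ?_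
  simpa only [h] using key w

end Synthesis

/-! ### Normal equations -/

/-- The equations say that `S a` is the orthogonal projection of `G` onto the range of `S`; take `d
= a` and apply Cauchy–Schwarz. -/
theorem norm_le_of_normal_equation {E H : Type*} [NormedAddCommGroup E]
    [InnerProductSpace ℂ E] [NormedAddCommGroup H] [InnerProductSpace ℂ H] {S : E →L[ℂ] H} {G : H} {a : E}
    (h : ∀ d, inner ℂ (S d) (S a) = inner ℂ (S d) G) : ‖S a‖ ≤ ‖G‖ := by
  have h1 : ‖S a‖ * ‖S a‖ ≤ ‖S a‖ * ‖G‖ := by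
    rw [← inner_self_eq_norm_mul_norm (𝕜 := ℂ), h a]
    exact re_inner_le_norm _ _
  rcases (norm_nonneg (S a)).eq_or_lt' with h0 | h0
  · rw [h0]; exact norm_nonneg _
  · exact le_of_mul_le_mul_left h1 h0

section NormalEquation

variable {E H : Type*} [NormedAddCommGroup E] [InnerProductSpace ℂ E] [CompleteSpace E]
  [NormedAddCommGroup H] [InnerProductSpace ℂ H] [CompleteSpace H]

/-- The normal equations of an operator that is bounded below are uniquely solvable. -/
theorem existsUnique_normal_equation (S : E →L[ℂ] H) {B : ℝ} (hB : 0 < B)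
    (hS : ∀ c, ‖c‖ ≤ B * ‖S c‖) (G : H) :
    ∃! a, ∀ d, inner ℂ (S d) (S a) = inner ℂ (S d) G := by
  set A : E →L[ℂ] E := S.adjoint ∘L S with hA
  -- Coercivity: `⟨A c, c⟩ = ‖S c‖² ≥ B⁻² ‖c‖²`.
  have hunit : IsUnit A := by
    refine ContinuousLinearMap.isUnit_of_forall_le_norm_inner_map A
      (c := NNReal.mk (B ^ 2)⁻¹ (by positivity))
      (NNReal.coe_pos.1 (by rw [NNReal.coe_mk]; positivity)) fun c => ?_
    have h1 : inner ℂ (A c) c = ((‖S c‖ ^ 2 : ℝ) : ℂ) := by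
      rw [hA, ContinuousLinearMap.comp_apply, ContinuousLinearMap.adjoint_inner_left,
        inner_self_eq_norm_sq_to_K]
      push_cast
      rfl
    rw [h1, Complex.norm_real, Real.norm_of_nonneg (by positivity), NNReal.coe_mk,
      mul_inv_le_iff₀ (by positivity), ← mul_pow, mul_comm]
    exact pow_le_pow_left₀ (norm_nonneg _) (hS c) 2
  have hbij := ContinuousLinearMap.isUnit_iff_bijective.1 hunit
  have hiff : ∀ a, (∀ d, inner ℂ (S d) (S a) = inner ℂ (S d) G) ↔ A a = S.adjoint G := by
    intro a
    constructor
    · intro h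
      refine ext_inner_left ℂ fun d => ?_
      rw [hA, ContinuousLinearMap.comp_apply, ContinuousLinearMap.adjoint_inner_right,
        ContinuousLinearMap.adjoint_inner_right, h]
    · intro h d
      rw [← ContinuousLinearMap.adjoint_inner_right, ← ContinuousLinearMap.adjoint_inner_right, ← h]
      rfl
  simp only [hiff]
  exact hbij.existsUnique _

end NormalEquation

/-! ### The Gaussian weight and its measure -/

/-- The Gaussian weight `e^{(π² - u²)/(4λ)}`, normalized to be `1` at the ends of the band. -/
def bandWeight (lam u : ℝ) : ℝ := Real.exp ((Real.pi ^ 2 - u ^ 2) / (4 * lam))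

/-- The measure with density `bandWeight lam`. -/
def weightedMeasure (lam : ℝ) : Measure ℝ :=
  volume.withDensity fun u => ENNReal.ofReal (bandWeight lam u)

theorem continuous_bandWeight (lam : ℝ) : Continuous (bandWeight lam) := by
  unfold bandWeight; fun_prop

theorem bandWeight_pos (lam u : ℝ) : 0 < bandWeight lam u := Real.exp_pos _

theorem measurable_ofReal_bandWeight (lam : ℝ) :
    Measurable fun u => ENNReal.ofReal (bandWeight lam u) :=
  (continuous_bandWeight lam).measurable.ennreal_ofReal

theorem one_le_bandWeight {lam u : ℝ} (hlam : 0 < lam) (hu : u ∈ Set.Icc (-Real.pi) Real.pi) :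
    1 ≤ bandWeight lam u := by
  refine Real.one_le_exp (div_nonneg ?_ (by positivity))
  nlinarith [hu.1, hu.2]

theorem bandWeight_le_one {lam u : ℝ} (hlam : 0 < lam) (hu : u ∉ Set.Icc (-Real.pi) Real.pi) :
    bandWeight lam u ≤ 1 := by
  refine Real.exp_le_one_iff.2 (div_nonpos_of_nonpos_of_nonneg ?_ (by positivity))
  rw [Set.mem_Icc, not_and_or, not_le, not_le] at hu
  have := Real.pi_pos
  rcases hu with h | h <;> nlinarith

theorem bandWeight_le_of_le {lam u : ℝ} (hlam : 0 < lam) (hlam1 : lam ≤ 1)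
    (hu : u ∉ Set.Icc (-Real.pi) Real.pi) : bandWeight lam u ≤ bandWeight 1 u := by
  have h0 : Real.pi ^ 2 - u ^ 2 ≤ 0 := by
    rw [Set.mem_Icc, not_and_or, not_le, not_le] at hu
    have := Real.pi_pos
    rcases hu with h | h <;> nlinarith
  refine Real.exp_le_exp.2 ?_
  rw [div_le_div_iff₀ (by positivity) (by positivity)]
  nlinarith

theorem bandWeight_le (lam u : ℝ) (hlam : 0 < lam) :
    bandWeight lam u ≤ Real.exp (Real.pi ^ 2 / (4 * lam)) := by
  refine Real.exp_le_exp.2 ?_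
  gcongr
  nlinarith [sq_nonneg u]

theorem bandWeight_eq (lam u : ℝ) :
    bandWeight lam u = Real.exp (Real.pi ^ 2 / (4 * lam)) * Real.exp (-(1 / (4 * lam)) * u ^ 2) := by
  rw [bandWeight, ← Real.exp_add]
  congr 1
  ring

theorem integrable_bandWeight {lam : ℝ} (hlam : 0 < lam) : Integrable (bandWeight lam) := by
  have := (integrable_exp_neg_mul_sq (b := 1 / (4 * lam)) (by positivity)).const_mul
    (Real.exp (Real.pi ^ 2 / (4 * lam)))
  exact this.congr (.of_forall fun u => (bandWeight_eq lam u).symm)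

theorem isFiniteMeasure_weightedMeasure {lam : ℝ} (hlam : 0 < lam) :
    IsFiniteMeasure (weightedMeasure lam) :=
  isFiniteMeasure_withDensity_ofReal (integrable_bandWeight hlam).2

theorem lintegral_weightedMeasure (lam : ℝ) (g : ℝ → ENNReal) :
    ∫⁻ u, g u ∂(weightedMeasure lam) = ∫⁻ u, ENNReal.ofReal (bandWeight lam u) * g u := by
  rw [weightedMeasure, lintegral_withDensity_eq_lintegral_mul_non_measurable _
    (measurable_ofReal_bandWeight lam) (.of_forall fun u => ENNReal.ofReal_lt_top)]
  rfl

theorem setLIntegral_weightedMeasure (lam : ℝ) (g : ℝ → ENNReal) {s : Set ℝ}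
    (hs : MeasurableSet s) :
    ∫⁻ u in s, g u ∂(weightedMeasure lam)
      = ∫⁻ u in s, ENNReal.ofReal (bandWeight lam u) * g u := by
  rw [← lintegral_indicator hs, lintegral_weightedMeasure, ← lintegral_indicator hs]
  refine lintegral_congr fun u => ?_
  by_cases h : u ∈ s <;> simp [h]

theorem setIntegral_weightedMeasure (lam : ℝ) (g : ℝ → ℂ) {s : Set ℝ} (hs : MeasurableSet s) :
    ∫ u in s, g u ∂(weightedMeasure lam) = ∫ u in s, (bandWeight lam u : ℂ) * g u := by
  rw [weightedMeasure, restrict_withDensity hs,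
    integral_withDensity_eq_integral_toReal_smul (measurable_ofReal_bandWeight lam)
    (.of_forall fun u => ENNReal.ofReal_lt_top)]
  refine integral_congr_ae (.of_forall fun u => ?_)
  simp [ENNReal.toReal_ofReal (bandWeight_pos lam u).le]

theorem integral_weightedMeasure (lam : ℝ) (g : ℝ → ℂ) :
    ∫ u, g u ∂(weightedMeasure lam) = ∫ u, (bandWeight lam u : ℂ) * g u := by
  simpa using setIntegral_weightedMeasure lam g MeasurableSet.univ

theorem weightedMeasure_absolutelyContinuous (lam : ℝ) : weightedMeasure lam ≪ volume :=
  withDensity_absolutelyContinuous _ _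

theorem absolutelyContinuous_weightedMeasure (lam : ℝ) : volume ≪ weightedMeasure lam :=
  withDensity_absolutelyContinuous' (measurable_ofReal_bandWeight lam).aemeasurable
    (.of_forall fun u => by
      simpa using bandWeight_pos lam u)

/-- Since the weight is at least `1` on the band, restriction to the unweighted band is a
contraction. Lower Riesz bounds therefore pass to the weighted space. -/
theorem bandMeasure_le_weightedMeasure {lam : ℝ} (hlam : 0 < lam) :
    bandMeasure ≤ weightedMeasure lam := by
  refine Measure.le_iff.2 fun s hs => ?_
  rw [weightedMeasure, withDensity_apply _ hs, bandMeasure, Measure.restrict_apply hs,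
    ← lintegral_indicator_one (hs.inter measurableSet_Icc), ← lintegral_indicator hs]
  refine lintegral_mono fun u => ?_
  by_cases h : u ∈ s ∩ Set.Icc (-Real.pi) Real.pi
  · rw [Set.indicator_of_mem h, Set.indicator_of_mem h.1]
    simpa using one_le_bandWeight hlam h.2
  · rw [Set.indicator_of_notMem h]
    exact zero_le

/-! ### Exponentials in the weighted space -/

theorem memLp_weightedExponential {lam : ℝ} (hlam : 0 < lam) (t : ℝ) :
    MemLp (fun u : ℝ => Complex.exp (-(Complex.I * t * u))) 2 (weightedMeasure lam) := by
  have := isFiniteMeasure_weightedMeasure hlam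
  refine MemLp.of_bound (Continuous.aestronglyMeasurable (by fun_prop)) 1 ?_
  refine Filter.Eventually.of_forall fun u => ?_
  rw [show -(Complex.I * (t : ℂ) * (u : ℂ)) = ((-(t * u) : ℝ) : ℂ) * Complex.I by push_cast; ring,
    Complex.norm_exp_ofReal_mul_I]

/-- The exponential `u ↦ e^{-itu}` as an element of the weighted `L²` space. -/
def weightedExponential {lam : ℝ} (hlam : 0 < lam) (t : ℝ) : Lp ℂ 2 (weightedMeasure lam) :=
  (memLp_weightedExponential hlam t).toLp _

theorem conj_exp_neg (t u : ℝ) :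
    (starRingEnd ℂ) (Complex.exp (-(Complex.I * t * u))) = Complex.exp (Complex.I * t * u) := by
  rw [← Complex.exp_conj]
  simp

theorem inner_weightedExponential {lam : ℝ} (hlam : 0 < lam) (t : ℝ)
    (v : Lp ℂ 2 (weightedMeasure lam)) :
    inner ℂ (weightedExponential hlam t) v
      = 2 * Real.pi * angularFourierInv (fun u => bandWeight lam u * v u) t := by
  rw [L2.inner_def, angularFourierInv, ← mul_assoc, mul_inv_cancel₀ (by simp), one_mul]
  trans ∫ u, Complex.exp (Complex.I * t * u) * v u ∂(weightedMeasure lam)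
  · refine integral_congr_ae ?_
    filter_upwards [(memLp_weightedExponential hlam t).coeFn_toLp] with u hu
    rw [weightedExponential, hu, RCLike.inner_apply, conj_exp_neg, mul_comm]
  · rw [integral_weightedMeasure]
    refine integral_congr_ae (.of_forall fun u => ?_)
    dsimp only
    ring

theorem inner_exponential (t : ℝ) {F : ℝ → ℂ} (hF : MemLp F 2 bandMeasure)
    (h0 : ∀ u ∉ Set.Icc (-Real.pi) Real.pi, F u = 0) :
    inner ℂ (exponential t) (hF.toLp F) = 2 * Real.pi * angularFourierInv F t := by
  rw [L2.inner_def, angularFourierInv, ← mul_assoc, mul_inv_cancel₀ (by simp), one_mul]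
  trans ∫ u, Complex.exp (Complex.I * t * u) * F u ∂bandMeasure
  · refine integral_congr_ae ?_
    filter_upwards [(memLp_exponential t).coeFn_toLp, hF.coeFn_toLp] with u hu hu'
    rw [exponential, hu, hu', RCLike.inner_apply, conj_exp_neg, mul_comm]
  · refine setIntegral_eq_integral_of_forall_compl_eq_zero fun u hu => ?_
    rw [h0 u hu, mul_zero]

/-- The total mass of the weighted measure. -/
def weightMass (lam : ℝ) : ℝ := Real.exp (Real.pi ^ 2 / (4 * lam)) * Real.sqrt (4 * Real.pi * lam)

theorem weightMass_pos {lam : ℝ} (hlam : 0 < lam) : 0 < weightMass lam :=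
  mul_pos (Real.exp_pos _) (Real.sqrt_pos.2 (by have := Real.pi_pos; positivity))

/-- The Gaussian kernel as a Gram matrix: the inner product is the Fourier integral of `w`, a
Gaussian with exponent `1/(4λ)`, evaluated at `t - s`. -/
theorem inner_weightedExponential_weightedExponential {lam : ℝ} (hlam : 0 < lam) (t s : ℝ) :
    inner ℂ (weightedExponential hlam t) (weightedExponential hlam s)
      = weightMass lam * gaussian lam (t - s) := by
  have hpi := Real.pi_pos
  rw [L2.inner_def]
  trans ∫ u, Complex.exp (Complex.I * ((t - s : ℝ) : ℂ) * u) ∂(weightedMeasure lam)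
  · refine integral_congr_ae ?_
    filter_upwards [(memLp_weightedExponential hlam t).coeFn_toLp,
      (memLp_weightedExponential hlam s).coeFn_toLp] with u hu hu'
    rw [weightedExponential, hu, weightedExponential, hu', RCLike.inner_apply, conj_exp_neg,
      ← Complex.exp_add]
    congr 1
    push_cast
    ring
  · rw [integral_weightedMeasure]
    have h := fourierIntegral_gaussian (b := ((1 / (4 * lam) : ℝ) : ℂ))
      (by rw [Complex.ofReal_re]; positivity) ((t - s : ℝ) : ℂ)
    have h1 : ∀ u : ℝ, (bandWeight lam u : ℂ) * Complex.exp (Complex.I * ((t - s : ℝ) : ℂ) * u)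
        = (Real.exp (Real.pi ^ 2 / (4 * lam)) : ℂ) * (Complex.exp (Complex.I * ((t - s : ℝ) : ℂ) * u)
          * Complex.exp (-((1 / (4 * lam) : ℝ) : ℂ) * u ^ 2)) := by
      intro u
      rw [bandWeight_eq]
      push_cast
      ring
    simp only [h1]
    rw [integral_const_mul, h, weightMass, gaussian]
    have h2 : ((Real.pi : ℂ) / ((1 / (4 * lam) : ℝ) : ℂ)) ^ (1 / 2 : ℂ)
        = (Real.sqrt (4 * Real.pi * lam) : ℂ) := by
      rw [Real.sqrt_eq_rpow, Complex.ofReal_cpow (by positivity)]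
      congr 1
      · push_cast; field_simp
      · push_cast; rfl
    have h3 : -((t - s : ℝ) : ℂ) ^ 2 / (4 * ((1 / (4 * lam) : ℝ) : ℂ))
        = ((-lam * (t - s) ^ 2 : ℝ) : ℂ) := by
      have : (lam : ℂ) ≠ 0 := by exact_mod_cast hlam.ne'
      push_cast
      field_simp
    rw [h2, h3]
    push_cast
    ring

/-! ### The Bessel bound off the band -/

/-- The block `(2πl - π, 2πl + π]`. -/
def freqBlock (l : ℤ) : Set ℝ :=
  Set.Ioc (-Real.pi + l • (2 * Real.pi)) (-Real.pi + (l + 1) • (2 * Real.pi))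

theorem measurableSet_freqBlock (l : ℤ) : MeasurableSet (freqBlock l) := measurableSet_Ioc

theorem lintegral_eq_tsum_freqBlock (g : ℝ → ENNReal) :
    ∫⁻ u, g u = ∑' l : ℤ, ∫⁻ u in freqBlock l, g u := by
  rw [← lintegral_iUnion measurableSet_freqBlock (Set.pairwise_disjoint_Ioc_add_zsmul _ _)]
  unfold freqBlock
  rw [iUnion_Ioc_add_zsmul (by positivity), Measure.restrict_univ]

theorem setLIntegral_freqBlock (g : ℝ → ENNReal) (l : ℤ) :
    ∫⁻ u in freqBlock l, g u
      = ∫⁻ u in Set.Ioc (-Real.pi) Real.pi, g (u + l • (2 * Real.pi)) := by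
  rw [← lintegral_indicator (measurableSet_freqBlock l), ← lintegral_indicator measurableSet_Ioc,
    ← lintegral_add_right_eq_self _ (l • (2 * Real.pi))]
  refine lintegral_congr fun u => ?_
  have : u + l • (2 * Real.pi) ∈ freqBlock l ↔ u ∈ Set.Ioc (-Real.pi) Real.pi := by
    simp only [freqBlock, Set.mem_Ioc, add_smul, one_smul]
    constructor <;> rintro ⟨h1, h2⟩ <;> constructor <;> linarith
  by_cases h : u ∈ Set.Ioc (-Real.pi) Real.pi
  · rw [Set.indicator_of_mem h, Set.indicator_of_mem (this.2 h)]
  · rw [Set.indicator_of_notMem h, Set.indicator_of_notMem (mt this.1 h)]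

/-- A bound for the weight off the band, constant on each block. -/
def blockBound (l : ℤ) : ℝ := 4 / (1 + (l : ℝ) ^ 2)

theorem summable_blockBound : Summable blockBound := by
  have h : Summable fun l : ℤ => 4 * (1 / (l : ℝ) ^ 2) :=
    (Real.summable_one_div_int_pow.2 (by norm_num)).mul_left 4
  -- Comparison with `4/l²` fails at `l = 0`, where Lean's `1/0` is `0`.
  refine Summable.of_norm_bounded_eventually h ?_
  filter_upwards [(Set.finite_singleton (0 : ℤ)).compl_mem_cofinite] with l hl
  have hl' : (l : ℝ) ≠ 0 := by exact_mod_cast hl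
  have : 0 < (l : ℝ) ^ 2 := by positivity
  rw [blockBound, Real.norm_of_nonneg (by positivity), mul_one_div]
  gcongr
  linarith

/-- The factor `max 1 lam` makes the bound independent of `λ` for `λ ≤ 1`. Only `e^y ≥ 1 + y` is
needed, since quadratic decay in `l` is already summable. -/
theorem bandWeight_le_blockBound {lam u : ℝ} (hlam : 0 < lam) {l : ℤ} (hu : u ∈ freqBlock l)
    (hu' : u ∉ Set.Icc (-Real.pi) Real.pi) : bandWeight lam u ≤ max 1 lam * blockBound l := by
  have hpi := Real.two_le_pi
  set m := max 1 lam with hm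
  have hm1 : 1 ≤ m := le_max_left _ _
  have hm2 : lam ≤ m := le_max_right _ _
  have hu1 : 2 * Real.pi * (l : ℝ) - Real.pi < u := by
    have := hu.1; rw [zsmul_eq_mul] at this; linarith
  have hu2 : u ≤ 2 * Real.pi * (l : ℝ) + Real.pi := by
    have := hu.2; rw [zsmul_eq_mul] at this; push_cast at this; linarith
  -- Block `0` lies inside the band.
  have hl : 1 ≤ |(l : ℝ)| := by
    by_contra! h
    rw [abs_lt] at h
    have h1 : l < 1 := by exact_mod_cast h.2
    have h2 : -1 < l := by exact_mod_cast h.1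
    have h3 : l = 0 := by omega
    rw [h3] at hu1 hu2
    exact hu' ⟨by push_cast at hu1; linarith, by push_cast at hu2; linarith⟩
  have habs : Real.pi * (2 * |(l : ℝ)| - 1) ≤ |u| := by
    rcases abs_cases (l : ℝ) with ⟨h, -⟩ | ⟨h, -⟩
    · rw [h]; exact le_trans (by linarith) (le_abs_self u)
    · rw [h]; exact le_trans (by linarith) (neg_le_abs u)
  set a := |(l : ℝ)| with ha
  have hsq : (Real.pi * (2 * a - 1)) ^ 2 ≤ u ^ 2 := by
    rw [← sq_abs u]
    exact pow_le_pow_left₀ (mul_nonneg (by linarith) (by linarith)) habs 2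
  have ha2 : (l : ℝ) ^ 2 = a ^ 2 := (sq_abs _).symm
  set y := (u ^ 2 - Real.pi ^ 2) / (4 * lam) with hy
  have hy1 : lam * y = (u ^ 2 - Real.pi ^ 2) / 4 := by rw [hy]; field_simp
  have haa : 0 ≤ a * (a - 1) := mul_nonneg (by linarith) (by linarith)
  have hy2 : a * (a - 1) ≤ lam * y := by
    have : 1 * (a * (a - 1)) ≤ Real.pi ^ 2 * (a * (a - 1)) :=
      mul_le_mul_of_nonneg_right (by nlinarith) haa
    rw [hy1]
    linarith
  have hy0 : 0 ≤ y := nonneg_of_mul_nonneg_right (haa.trans hy2) hlam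
  have hw : bandWeight lam u = (Real.exp y)⁻¹ := by
    rw [bandWeight, ← Real.exp_neg, hy]
    congr 1
    ring
  rw [hw, blockBound, ha2]
  refine (inv_anti₀ (by positivity) (by linarith [Real.add_one_le_exp y] : 1 + y ≤ _)).trans ?_
  rw [← mul_div_assoc, inv_le_iff_one_le_mul₀ (by positivity), div_mul_eq_mul_div, one_le_div (by positivity)]
  -- What is needed is `1 + a² ≤ 4m(1 + y)`. From `m ≥ 1` and `m y ≥ a(a - 1)`, the difference is at
  -- least `3a² - 4a + 3 = 2(a - 1)² + a² + 1`.
  have h1 : lam * y ≤ m * y := mul_le_mul_of_nonneg_right hm2 hy0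
  nlinarith [sq_nonneg (a - 1)]

theorem setLIntegral_le_of_freqBlock {q : ℝ → ENNReal} {M : ENNReal} {lam : ℝ} (hlam : 0 < lam)
    (hq : ∀ l, ∫⁻ u in freqBlock l, q u ≤ M) :
    ∫⁻ u in (Set.Icc (-Real.pi) Real.pi)ᶜ, q u ∂(weightedMeasure lam)
      ≤ ENNReal.ofReal (max 1 lam * ∑' l, blockBound l) * M := by
  rw [setLIntegral_weightedMeasure _ _ measurableSet_Icc.compl,
    ← lintegral_indicator measurableSet_Icc.compl, lintegral_eq_tsum_freqBlock, ← tsum_mul_left,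
    ENNReal.ofReal_tsum_of_nonneg (fun l => by unfold blockBound; positivity)
      (summable_blockBound.mul_left _), ← ENNReal.tsum_mul_right]
  refine ENNReal.tsum_le_tsum fun l => ?_
  trans ∫⁻ u in freqBlock l, ENNReal.ofReal (max 1 lam * blockBound l) * q u
  · refine setLIntegral_mono' (measurableSet_freqBlock l) fun u hu => ?_
    by_cases h : u ∈ Set.Icc (-Real.pi) Real.pi
    · rw [Set.indicator_of_notMem (by simpa using h)]
      exact zero_le
    · rw [Set.indicator_of_mem (by exact h)]
      gcongr
      exact bandWeight_le_blockBound hlam hu h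
  · rw [lintegral_const_mul' _ _ ENNReal.ofReal_ne_top]
    gcongr
    exact hq l

/-- The trigonometric sum with frequencies `x` and coefficients `c`. -/
def trigSum (x : ℤ → ℝ) (s : Finset ℤ) (c : ℤ → ℂ) (u : ℝ) : ℂ :=
  ∑ j ∈ s, c j * Complex.exp (-(Complex.I * x j * u))

theorem eLpNorm_two_sq_eq_lintegral {α : Type*} [MeasurableSpace α] {μ : Measure α} (g : α → ℂ) :
    eLpNorm g 2 μ ^ 2 = ∫⁻ u, ‖g u‖ₑ ^ 2 ∂μ := by
  have h := eLpNorm_nnreal_pow_eq_lintegral (f := g) (μ := μ) (p := 2) (by norm_num)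
  norm_num at h
  exact h

theorem ofReal_norm_sq_eq_lintegral {α : Type*} [MeasurableSpace α] {μ : Measure α}
    (v : Lp ℂ 2 μ) : ENNReal.ofReal (‖v‖ ^ 2) = ∫⁻ u, ‖v u‖ₑ ^ 2 ∂μ := by
  rw [← eLpNorm_two_sq_eq_lintegral, ← Lp.enorm_def, ENNReal.ofReal_pow (norm_nonneg _), ofReal_norm]

theorem coeFn_sum_smul_toLp {α : Type*} [MeasurableSpace α] {μ : Measure α} {g : ℤ → α → ℂ}
    (hg : ∀ j, MemLp (g j) 2 μ) (s : Finset ℤ) (c : ℤ → ℂ) :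
    ⇑(∑ j ∈ s, c j • (hg j).toLp (g j)) =ᵐ[μ] fun u => ∑ j ∈ s, c j * g j u := by
  classical
  induction s using Finset.induction_on with
  | empty =>
    simp only [Finset.sum_empty]
    exact Lp.coeFn_zero ℂ 2 μ
  | insert a s ha ih =>
    rw [Finset.sum_insert ha]
    filter_upwards [Lp.coeFn_add (c a • (hg a).toLp (g a)) (∑ j ∈ s, c j • (hg j).toLp (g j)), ih,
      Lp.coeFn_smul (c a) ((hg a).toLp (g a)), (hg a).coeFn_toLp] with u h1 h2 h3 h4
    rw [h1, Pi.add_apply, h2, h3, Pi.smul_apply, h4, Finset.sum_insert ha, smul_eq_mul]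

theorem coeFn_sum_smul_exponential (x : ℤ → ℝ) (s : Finset ℤ) (c : ℤ → ℂ) :
    ⇑(∑ j ∈ s, c j • exponential (x j)) =ᵐ[bandMeasure] trigSum x s c :=
  coeFn_sum_smul_toLp (fun j => memLp_exponential (x j)) s c

theorem coeFn_sum_smul_weightedExponential {lam : ℝ} (hlam : 0 < lam) (x : ℤ → ℝ) (s : Finset ℤ)
    (c : ℤ → ℂ) :
    ⇑(∑ j ∈ s, c j • weightedExponential hlam (x j)) =ᵐ[weightedMeasure lam] trigSum x s c :=
  coeFn_sum_smul_toLp (fun j => memLp_weightedExponential hlam (x j)) s c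

/-- Translation by `2πl` multiplies the coefficient `c j` by a unimodular number, so the Bessel
constant of the band serves every block. -/
theorem lintegral_freqBlock_trigSum_le {x : ℤ → ℝ} {B : ℝ}
    (hB : ∀ (s : Finset ℤ) (c : ℤ → ℂ),
      ‖∑ j ∈ s, c j • exponential (x j)‖ ^ 2 ≤ B ^ 2 * ∑ j ∈ s, ‖c j‖ ^ 2)
    (s : Finset ℤ) (c : ℤ → ℂ) (l : ℤ) :
    ∫⁻ u in freqBlock l, ‖trigSum x s c u‖ₑ ^ 2
      ≤ ENNReal.ofReal (B ^ 2 * ∑ j ∈ s, ‖c j‖ ^ 2) := by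
  set d : ℤ → ℂ := fun j => c j * Complex.exp (((-(x j * (l * (2 * Real.pi))) : ℝ) : ℂ) * Complex.I)
    with hd
  have hnorm : ∀ j, ‖d j‖ = ‖c j‖ := fun j => by
    rw [hd]; dsimp only; rw [norm_mul, Complex.norm_exp_ofReal_mul_I, mul_one]
  have htrans : ∀ u : ℝ, trigSum x s c (u + l • (2 * Real.pi)) = trigSum x s d u := fun u => by
    refine Finset.sum_congr rfl fun j _ => ?_
    rw [hd]
    dsimp only
    rw [mul_assoc (c j), ← Complex.exp_add, zsmul_eq_mul]
    congr 2
    push_cast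
    ring
  rw [setLIntegral_freqBlock]
  simp only [htrans]
  trans ∫⁻ u, ‖trigSum x s d u‖ₑ ^ 2 ∂bandMeasure
  · exact lintegral_mono_set Set.Ioc_subset_Icc_self
  · have h1 := hB s d
    simp only [hnorm] at h1
    refine le_trans (le_of_eq ?_) (ENNReal.ofReal_le_ofReal h1)
    rw [ofReal_norm_sq_eq_lintegral]
    refine lintegral_congr_ae ?_
    filter_upwards [coeFn_sum_smul_exponential x s d] with u hu
    rw [hu]

/-- The sum of the block bounds, the constant in the Bessel bound off the band. -/
def tailConst : ℝ := ∑' l, blockBound l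

theorem tailConst_nonneg : 0 ≤ tailConst :=
  tsum_nonneg fun l => by unfold blockBound; positivity

/-! ### Restriction to the band and to its complement -/

/-- Restriction of `L²` functions to a smaller measure. -/
def lpMono {α : Type*} [MeasurableSpace α] {μ ν : Measure α} (h : ν ≤ μ) : Lp ℂ 2 μ →L[ℂ] Lp ℂ 2 ν :=
  LinearMap.mkContinuous
    { toFun := fun v => ((Lp.memLp v).mono_measure h).toLp v
      map_add' := fun v w => by
        refine Lp.ext ?_
        filter_upwards [((Lp.memLp (v + w)).mono_measure h).coeFn_toLp,
          ((Lp.memLp v).mono_measure h).coeFn_toLp, ((Lp.memLp w).mono_measure h).coeFn_toLp,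
          h.absolutelyContinuous (Lp.coeFn_add v w),
          Lp.coeFn_add (((Lp.memLp v).mono_measure h).toLp v)
            (((Lp.memLp w).mono_measure h).toLp w)] with u h1 h2 h3 h4 h5
        rw [h1, h5, Pi.add_apply, h2, h3, h4, Pi.add_apply]
      map_smul' := fun a v => by
        refine Lp.ext ?_
        filter_upwards [((Lp.memLp (a • v)).mono_measure h).coeFn_toLp,
          ((Lp.memLp v).mono_measure h).coeFn_toLp,
          h.absolutelyContinuous (Lp.coeFn_smul a v),
          Lp.coeFn_smul a (((Lp.memLp v).mono_measure h).toLp v)] with u h1 h2 h4 h5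
        rw [h1, RingHom.id_apply, h5, Pi.smul_apply, h2, h4, Pi.smul_apply] }
    1 fun v => by
      rw [one_mul, LinearMap.coe_mk, AddHom.coe_mk, Lp.norm_toLp, Lp.norm_def]
      exact ENNReal.toReal_mono (Lp.eLpNorm_ne_top v) (eLpNorm_mono_measure _ h)

section LpMono

variable {α : Type*} [MeasurableSpace α] {μ ν : Measure α} (h : ν ≤ μ)

theorem lpMono_coeFn (v : Lp ℂ 2 μ) : lpMono h v =ᵐ[ν] v :=
  ((Lp.memLp v).mono_measure h).coeFn_toLp

theorem norm_lpMono_le (v : Lp ℂ 2 μ) : ‖lpMono h v‖ ≤ ‖v‖ := by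
  simpa only [one_mul] using
    (lpMono h).le_of_opNorm_le (LinearMap.mkContinuous_norm_le _ zero_le_one _) v

theorem lpMono_toLp {g : α → ℂ} (hμ : MemLp g 2 μ) (hν : MemLp g 2 ν) :
    lpMono h (hμ.toLp g) = hν.toLp g :=
  Lp.ext ((lpMono_coeFn h _).trans
    ((h.absolutelyContinuous.ae_eq hμ.coeFn_toLp).trans hν.coeFn_toLp.symm))

end LpMono

theorem lpMono_weightedExponential {lam : ℝ} (hlam : 0 < lam) (t : ℝ) :
    lpMono (bandMeasure_le_weightedMeasure hlam) (weightedExponential hlam t) = exponential t :=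
  lpMono_toLp _ _ _

/-- The part of the weighted measure off the band. -/
def tailMeasure (lam : ℝ) : Measure ℝ :=
  (weightedMeasure lam).restrict (Set.Icc (-Real.pi) Real.pi)ᶜ

theorem tailMeasure_le (lam : ℝ) : tailMeasure lam ≤ weightedMeasure lam :=
  Measure.restrict_le_self

theorem norm_sq_lpMono_tail_sum_le {x : ℤ → ℝ} {B : ℝ}
    (hB : ∀ (s : Finset ℤ) (c : ℤ → ℂ),
      ‖∑ j ∈ s, c j • exponential (x j)‖ ^ 2 ≤ B ^ 2 * ∑ j ∈ s, ‖c j‖ ^ 2)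
    {lam : ℝ} (hlam : 0 < lam) (s : Finset ℤ) (c : ℤ → ℂ) :
    ‖lpMono (tailMeasure_le lam) (∑ j ∈ s, c j • weightedExponential hlam (x j))‖ ^ 2
      ≤ max 1 lam * tailConst * B ^ 2 * ∑ j ∈ s, ‖c j‖ ^ 2 := by
  have h0 : 0 ≤ max 1 lam * tailConst := mul_nonneg (by positivity) tailConst_nonneg
  have h1 : 0 ≤ ∑ j ∈ s, ‖c j‖ ^ 2 := Finset.sum_nonneg fun _ _ => by positivity
  rw [← ENNReal.ofReal_le_ofReal_iff (by positivity), ofReal_norm_sq_eq_lintegral, mul_assoc,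
    ENNReal.ofReal_mul h0]
  refine le_trans (le_of_eq ?_) (setLIntegral_le_of_freqBlock hlam
    (lintegral_freqBlock_trigSum_le hB s c))
  refine lintegral_congr_ae ?_
  filter_upwards [lpMono_coeFn (tailMeasure_le lam) (∑ j ∈ s, c j • weightedExponential hlam (x j)),
    (tailMeasure_le lam).absolutelyContinuous (coeFn_sum_smul_weightedExponential hlam x s c)]
    with u h2 h3
  rw [h2, h3]

/-- The constant blows up as `λ → 0`. It serves only to define the synthesis operator for fixed `λ`;
the limit uses the bound off the band. -/
theorem norm_sq_sum_smul_weightedExponential_le {x : ℤ → ℝ} {B : ℝ}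
    (hB : ∀ (s : Finset ℤ) (c : ℤ → ℂ),
      ‖∑ j ∈ s, c j • exponential (x j)‖ ^ 2 ≤ B ^ 2 * ∑ j ∈ s, ‖c j‖ ^ 2)
    {lam : ℝ} (hlam : 0 < lam) (s : Finset ℤ) (c : ℤ → ℂ) :
    ‖∑ j ∈ s, c j • weightedExponential hlam (x j)‖ ^ 2
      ≤ (Real.exp (Real.pi ^ 2 / (4 * lam)) * B ^ 2 + max 1 lam * tailConst * B ^ 2)
        * ∑ j ∈ s, ‖c j‖ ^ 2 := by
  have h0 : 0 ≤ max 1 lam * tailConst := mul_nonneg (by positivity) tailConst_nonneg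
  have h1 : 0 ≤ ∑ j ∈ s, ‖c j‖ ^ 2 := Finset.sum_nonneg fun _ _ => by positivity
  set v := ∑ j ∈ s, c j • weightedExponential hlam (x j) with hv
  have hcoe := coeFn_sum_smul_weightedExponential hlam x s c
  rw [add_mul, ← ENNReal.ofReal_le_ofReal_iff (by positivity),
    ENNReal.ofReal_add (by positivity) (by positivity), ofReal_norm_sq_eq_lintegral,
    ← lintegral_add_compl _ (measurableSet_Icc (a := -Real.pi) (b := Real.pi))]
  refine add_le_add ?_ ?_
  · rw [setLIntegral_weightedMeasure _ _ measurableSet_Icc, mul_assoc,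
      ENNReal.ofReal_mul (Real.exp_pos _).le]
    refine le_trans ?_ (mul_le_mul_right (ENNReal.ofReal_le_ofReal (hB s c)) _)
    rw [ofReal_norm_sq_eq_lintegral, ← lintegral_const_mul' _ _ ENNReal.ofReal_ne_top]
    refine lintegral_mono_ae ?_
    filter_upwards [coeFn_sum_smul_exponential x s c,
      (bandMeasure_le_weightedMeasure hlam).absolutelyContinuous hcoe] with u h2 h3
    rw [h2, h3]
    gcongr
    exact bandWeight_le lam u hlam
  · refine le_trans (le_of_eq ?_)
      (ENNReal.ofReal_le_ofReal (norm_sq_lpMono_tail_sum_le hB hlam s c))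
    rw [ofReal_norm_sq_eq_lintegral]
    refine lintegral_congr_ae ?_
    filter_upwards [lpMono_coeFn (tailMeasure_le lam) v] with u h2
    rw [h2]

/-! ### Spectra of the form `w h` -/

/-- The product of an element of the weighted space with the weight. -/
def weightMul (lam : ℝ) (h : ℝ → ℂ) (u : ℝ) : ℂ := bandWeight lam u * h u

theorem enorm_weightMul (lam : ℝ) (h : ℝ → ℂ) (u : ℝ) :
    ‖weightMul lam h u‖ₑ = ENNReal.ofReal (bandWeight lam u) * ‖h u‖ₑ := by
  rw [weightMul, enorm_mul, ← ofReal_norm, Complex.norm_real,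
    Real.norm_of_nonneg (bandWeight_pos lam u).le]

section WeightMul

variable {lam : ℝ}

theorem aestronglyMeasurable_weightMul (h : Lp ℂ 2 (weightedMeasure lam)) :
    AEStronglyMeasurable (weightMul lam h) volume :=
  (Complex.continuous_ofReal.comp (continuous_bandWeight lam)).aestronglyMeasurable.mul
    ((Lp.aestronglyMeasurable h).mono_ac (absolutelyContinuous_weightedMeasure lam))

theorem memLp_weightMul (hlam : 0 < lam) (h : Lp ℂ 2 (weightedMeasure lam)) :
    MemLp (weightMul lam h) 2 volume := by
  refine ⟨aestronglyMeasurable_weightMul h, ?_⟩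
  have h1 : eLpNorm (weightMul lam h) 2 volume ^ 2
      ≤ ENNReal.ofReal (Real.exp (Real.pi ^ 2 / (4 * lam))) * ENNReal.ofReal (‖h‖ ^ 2) := by
    rw [eLpNorm_two_sq_eq_lintegral, ofReal_norm_sq_eq_lintegral, lintegral_weightedMeasure,
      ← lintegral_const_mul' _ _ ENNReal.ofReal_ne_top]
    refine lintegral_mono fun u => ?_
    rw [enorm_weightMul, mul_pow, sq (ENNReal.ofReal _), mul_assoc]
    gcongr
    exact bandWeight_le lam u hlam
  have h2 := h1.trans_lt (ENNReal.mul_lt_top ENNReal.ofReal_lt_top ENNReal.ofReal_lt_top)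
  by_contra h3
  rw [not_lt, top_le_iff] at h3
  rw [h3] at h2
  simp at h2

theorem integrable_weightMul (hlam : 0 < lam) (h : Lp ℂ 2 (weightedMeasure lam)) :
    Integrable (weightMul lam h) := by
  have := isFiniteMeasure_weightedMeasure hlam
  refine ⟨aestronglyMeasurable_weightMul h, ?_⟩
  have h1 : Integrable h (weightedMeasure lam) := (Lp.memLp h).integrable (by norm_num)
  have h2 := h1.2
  rw [HasFiniteIntegral, lintegral_weightedMeasure] at h2
  rw [HasFiniteIntegral]
  simpa only [enorm_weightMul] using h2

theorem setLIntegral_compl_weightMul_sq_le (hlam : 0 < lam)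
    (h : Lp ℂ 2 (weightedMeasure lam)) :
    ∫⁻ u in (Set.Icc (-Real.pi) Real.pi)ᶜ, ‖weightMul lam h u‖ₑ ^ 2 ≤ ENNReal.ofReal (‖h‖ ^ 2) := by
  rw [ofReal_norm_sq_eq_lintegral, lintegral_weightedMeasure]
  refine le_trans (setLIntegral_mono' measurableSet_Icc.compl fun u hu => ?_)
    (setLIntegral_le_lintegral _ _)
  rw [enorm_weightMul, mul_pow, sq (ENNReal.ofReal _), mul_assoc]
  refine mul_le_mul_right (mul_le_of_le_one_left zero_le ?_) _
  exact ENNReal.ofReal_le_one.2 (bandWeight_le_one hlam hu)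

/-- Cauchy–Schwarz for the tail measure. Off the band the weight increases with `λ`, so for `λ ≤ 1`
the tail mass is bounded by the fixed total mass at `λ = 1`. -/
theorem setLIntegral_compl_weightMul_le (hlam : 0 < lam) (hlam1 : lam ≤ 1)
    (h : Lp ℂ 2 (weightedMeasure lam)) :
    ∫⁻ u in (Set.Icc (-Real.pi) Real.pi)ᶜ, ‖weightMul lam h u‖ₑ
      ≤ ENNReal.ofReal ‖h‖ * weightedMeasure 1 Set.univ ^ (1 / 2 : ℝ) := by
  have h1 : ∫⁻ u in (Set.Icc (-Real.pi) Real.pi)ᶜ, ‖weightMul lam h u‖ₑ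
      = eLpNorm h 1 (tailMeasure lam) := by
    rw [eLpNorm_one_eq_lintegral_enorm, tailMeasure,
      setLIntegral_weightedMeasure _ _ measurableSet_Icc.compl]
    simp only [enorm_weightMul]
  have h2 := eLpNorm_le_eLpNorm_mul_rpow_measure_univ (μ := tailMeasure lam) (f := h) (p := 1)
    (q := 2) (by norm_num) ((Lp.aestronglyMeasurable h).mono_measure (tailMeasure_le lam))
  rw [h1]
  refine h2.trans (mul_le_mul' ?_ ?_)
  · rw [ofReal_norm, Lp.enorm_def]
    exact eLpNorm_mono_measure _ (tailMeasure_le lam)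
  · norm_num
    refine ENNReal.rpow_le_rpow ?_ (by norm_num)
    have e : ∀ l : ℝ, tailMeasure l Set.univ
        = ∫⁻ u in (Set.Icc (-Real.pi) Real.pi)ᶜ, ENNReal.ofReal (bandWeight l u) := fun l => by
      rw [← lintegral_one, tailMeasure, setLIntegral_weightedMeasure _ _ measurableSet_Icc.compl]
      simp
    refine le_trans ?_ (tailMeasure_le 1 Set.univ)
    rw [e, e]
    refine setLIntegral_mono' measurableSet_Icc.compl fun u hu => ?_
    exact ENNReal.ofReal_le_ofReal (bandWeight_le_of_le hlam hlam1 hu)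

end WeightMul

/-! ### The data `F/w` in the weighted space -/

section Dual

variable {F : ℝ → ℂ}

/-- The Riesz representative, in the weighted space, of pairing with `F` on the band. -/
def weightDiv (lam : ℝ) (F : ℝ → ℂ) (u : ℝ) : ℂ := (bandWeight lam u : ℂ)⁻¹ * F u

theorem ofReal_bandWeight_mul_enorm_weightDiv_sq (lam : ℝ) (F : ℝ → ℂ) (u : ℝ) :
    ENNReal.ofReal (bandWeight lam u) * ‖weightDiv lam F u‖ₑ ^ 2
      = ENNReal.ofReal (bandWeight lam u)⁻¹ * ‖F u‖ₑ ^ 2 := by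
  have h := bandWeight_pos lam u
  have h1 : ‖((bandWeight lam u : ℂ))⁻¹‖ₑ = ENNReal.ofReal (bandWeight lam u)⁻¹ := by
    rw [← ofReal_norm, norm_inv, Complex.norm_real, Real.norm_of_nonneg h.le]
  rw [weightDiv, enorm_mul, h1, mul_pow, ← mul_assoc, ← ENNReal.ofReal_pow (inv_nonneg.2 h.le),
    ← ENNReal.ofReal_mul h.le]
  congr 2
  field_simp

theorem ofReal_inv_bandWeight_mul_le {lam : ℝ} (hlam : 0 < lam)
    (h0 : ∀ u ∉ Set.Icc (-Real.pi) Real.pi, F u = 0) (u : ℝ) :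
    ENNReal.ofReal (bandWeight lam u)⁻¹ * ‖F u‖ₑ ^ 2 ≤ ‖F u‖ₑ ^ 2 := by
  by_cases hu : u ∈ Set.Icc (-Real.pi) Real.pi
  · refine mul_le_of_le_one_left zero_le (ENNReal.ofReal_le_one.2 ?_)
    exact inv_le_one_of_one_le₀ (one_le_bandWeight hlam hu)
  · simp [h0 u hu]

theorem eLpNorm_sq_weightDiv (lam : ℝ) (F : ℝ → ℂ) :
    eLpNorm (weightDiv lam F) 2 (weightedMeasure lam) ^ 2
      = ∫⁻ u, ENNReal.ofReal (bandWeight lam u)⁻¹ * ‖F u‖ₑ ^ 2 := by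
  rw [eLpNorm_two_sq_eq_lintegral, lintegral_weightedMeasure]
  simp only [ofReal_bandWeight_mul_enorm_weightDiv_sq]

theorem lintegral_enorm_sq_lt_top (hF : MemLp F 2 volume) : ∫⁻ u, ‖F u‖ₑ ^ 2 < ⊤ := by
  rw [← eLpNorm_two_sq_eq_lintegral]
  exact ENNReal.pow_lt_top hF.2

theorem memLp_weightDiv (hF : MemLp F 2 volume)
    (h0 : ∀ u ∉ Set.Icc (-Real.pi) Real.pi, F u = 0) {lam : ℝ} (hlam : 0 < lam) :
    MemLp (weightDiv lam F) 2 (weightedMeasure lam) := by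
  constructor
  · refine AEStronglyMeasurable.mono_ac (weightedMeasure_absolutelyContinuous lam) ?_
    refine AEStronglyMeasurable.mul (Continuous.aestronglyMeasurable ?_) hF.1
    exact (Complex.continuous_ofReal.comp (continuous_bandWeight lam)).inv₀ fun u => by
      simpa using (bandWeight_pos lam u).ne'
  · by_contra h3
    rw [not_lt, top_le_iff] at h3
    have h1 := (lintegral_mono (μ := volume)
      (ofReal_inv_bandWeight_mul_le hlam h0)).trans_lt (lintegral_enorm_sq_lt_top hF)
    rw [← eLpNorm_sq_weightDiv, h3] at h1
    simp at h1

/-- The weight cancels, and `F` vanishes off the band, so the weighted pairing with `F/w` sees `v`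
only on the band. -/
theorem inner_weightDiv (hF : MemLp F 2 volume) (hF' : MemLp F 2 bandMeasure)
    (h0 : ∀ u ∉ Set.Icc (-Real.pi) Real.pi, F u = 0) {lam : ℝ} (hlam : 0 < lam)
    (v : Lp ℂ 2 (weightedMeasure lam)) :
    inner ℂ v ((memLp_weightDiv hF h0 hlam).toLp _)
      = inner ℂ (lpMono (bandMeasure_le_weightedMeasure hlam) v) (hF'.toLp F) := by
  rw [L2.inner_def, L2.inner_def]
  trans ∫ u, weightDiv lam F u * (starRingEnd ℂ) (v u) ∂(weightedMeasure lam)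
  · refine integral_congr_ae ?_
    filter_upwards [(memLp_weightDiv hF h0 hlam).coeFn_toLp] with u hu
    rw [hu, RCLike.inner_apply]
  trans ∫ u, F u * (starRingEnd ℂ) (v u)
  · rw [integral_weightedMeasure]
    refine integral_congr_ae (.of_forall fun u => ?_)
    have : (bandWeight lam u : ℂ) ≠ 0 := by exact_mod_cast (bandWeight_pos lam u).ne'
    simp only [weightDiv]
    field_simp
  · rw [← setIntegral_eq_integral_of_forall_compl_eq_zero (s := Set.Icc (-Real.pi) Real.pi)
      fun u hu => by rw [h0 u hu, zero_mul]]
    refine integral_congr_ae ?_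
    filter_upwards [hF'.coeFn_toLp, lpMono_coeFn (bandMeasure_le_weightedMeasure hlam) v]
      with u h1 h2
    rw [h1, h2, RCLike.inner_apply]

/-- The squared norm is `∫ |F|²/w`. It is dominated by `|F|²`, and `1/w → 0` at every interior point
of the band. -/
theorem tendsto_eLpNorm_weightDiv (hF : MemLp F 2 volume)
    (h0 : ∀ u ∉ Set.Icc (-Real.pi) Real.pi, F u = 0) :
    Tendsto (fun lam => eLpNorm (weightDiv lam F) 2 (weightedMeasure lam)) (𝓝[>] 0) (𝓝 0) := by
  have hpi := Real.pi_pos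
  have h1 : Tendsto (fun lam => ∫⁻ u, ENNReal.ofReal (bandWeight lam u)⁻¹ * ‖F u‖ₑ ^ 2)
      (𝓝[>] 0) (𝓝 (∫⁻ _ : ℝ, 0)) := by
    refine tendsto_lintegral_filter_of_dominated_convergence' (fun u => ‖F u‖ₑ ^ 2) ?_ ?_
      (lintegral_enorm_sq_lt_top hF).ne ?_
    · refine .of_forall fun lam => ?_
      exact ((continuous_bandWeight lam).measurable.inv.ennreal_ofReal).aemeasurable.mul
        (hF.1.enorm.pow_const 2)
    · filter_upwards [self_mem_nhdsWithin] with lam hlam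
      exact .of_forall fun u => ofReal_inv_bandWeight_mul_le hlam h0 u
    -- At `±π` the weight is `1` for every `λ`; these two points form a null set.
    · have hne : ∀ᵐ u : ℝ, u ∉ ({-Real.pi, Real.pi} : Set ℝ) :=
        measure_eq_zero_iff_ae_notMem.1 ((Set.toFinite _).measure_zero _)
      filter_upwards [hne] with u hu
      by_cases hb : u ∈ Set.Icc (-Real.pi) Real.pi
      · simp only [Set.mem_insert_iff, Set.mem_singleton_iff, not_or] at hu
        have hu1 : -Real.pi < u := lt_of_le_of_ne hb.1 (Ne.symm hu.1)
        have hu2 : u < Real.pi := lt_of_le_of_ne hb.2 hu.2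
        have hpos : 0 < (Real.pi ^ 2 - u ^ 2) / 4 := by nlinarith
        have h2 : Tendsto (fun lam : ℝ => (bandWeight lam u)⁻¹) (𝓝[>] 0) (𝓝 0) := by
          have h3 : Tendsto (fun lam : ℝ => (Real.pi ^ 2 - u ^ 2) / 4 * lam⁻¹) (𝓝[>] 0) atTop :=
            tendsto_inv_nhdsGT_zero.const_mul_atTop hpos
          refine (Real.tendsto_exp_neg_atTop_nhds_zero.comp h3).congr fun lam => ?_
          rw [Function.comp, bandWeight, ← Real.exp_neg]
          congr 2
          rw [← div_div, div_eq_mul_inv _ lam]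
        have h4 := ENNReal.tendsto_ofReal h2
        rw [ENNReal.ofReal_zero] at h4
        have h5 := ENNReal.Tendsto.mul_const (b := ‖F u‖ₑ ^ 2) h4 (Or.inr (by simp))
        rwa [zero_mul] at h5
      · simp [h0 u hb]
  rw [lintegral_zero] at h1
  simp only [← eLpNorm_sq_weightDiv] at h1
  have h6 := (ENNReal.continuous_rpow_const (y := 1 / 2)).tendsto 0 |>.comp h1
  rw [ENNReal.zero_rpow_of_pos (by norm_num)] at h6
  refine h6.congr fun lam => ?_
  rw [Function.comp, ← ENNReal.rpow_natCast, ← ENNReal.rpow_mul]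
  norm_num

end Dual

/-! ### Solving the interpolation equations -/

/-- The synthesis operator of the exponentials `e^{-i x_j u}` in the weighted space: it extends the
synthesis operator on the band, with a Bessel bound off the band uniform for `λ ≤ 1`. -/
theorem exists_weighted_synthesis {x : ℤ → ℝ} {B : ℝ}
    {T : lp (fun _ : ℤ => ℂ) 2 →L[ℂ] Lp ℂ 2 bandMeasure}
    (hfin : ∀ (s : Finset ℤ) (c : ℤ → ℂ),
      ‖∑ j ∈ s, c j • exponential (x j)‖ ^ 2 ≤ B ^ 2 * ∑ j ∈ s, ‖c j‖ ^ 2)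
    (hT : ∀ c, HasSum (fun j => c j • exponential (x j)) (T c)) {lam : ℝ} (hlam : 0 < lam) :
    ∃ S : lp (fun _ : ℤ => ℂ) 2 →L[ℂ] Lp ℂ 2 (weightedMeasure lam),
      (∀ c, HasSum (fun j => c j • weightedExponential hlam (x j)) (S c)) ∧
      (∀ c, lpMono (bandMeasure_le_weightedMeasure hlam) (S c) = T c) ∧
      ∀ c, ‖lpMono (tailMeasure_le lam) (S c)‖ ^ 2 ≤ max 1 lam * tailConst * B ^ 2 * ‖c‖ ^ 2 := by
  have ht := tailConst_nonneg
  obtain ⟨S, hS, -⟩ := exists_synthesis (by positivity)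
    (norm_sq_sum_smul_weightedExponential_le hfin hlam)
  refine ⟨S, hS, fun c => ?_, fun c => ?_⟩
  · have h1 := (hS c).mapL (lpMono (bandMeasure_le_weightedMeasure hlam))
    simp only [map_smul, lpMono_weightedExponential] at h1
    exact h1.unique (hT c)
  · have h1 := (hS c).mapL (lpMono (tailMeasure_le lam))
    have h2 := (lp_summable_sq c).hasSum.mul_left (max 1 lam * tailConst * B ^ 2)
    rw [← lp_norm_sq] at h2
    refine le_of_tendsto_of_tendsto' (h1.norm.pow 2) h2 fun s => ?_
    rw [← map_sum, ← Finset.mul_sum]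
    exact norm_sq_lpMono_tail_sum_le hfin hlam s c

/-- On the band the weight is absorbed into `h`, leaving an unweighted pairing comparable with `F`;
off the band it stays in the measure. -/
theorem inner_lpMono_eq {lam : ℝ} (hlam : 0 < lam) (v h : Lp ℂ 2 (weightedMeasure lam))
    (hW : MemLp (weightMul lam h) 2 bandMeasure) :
    inner ℂ v h = inner ℂ (lpMono (bandMeasure_le_weightedMeasure hlam) v) (hW.toLp _)
      + inner ℂ (lpMono (tailMeasure_le lam) v) (lpMono (tailMeasure_le lam) h) := by
  rw [L2.inner_def, L2.inner_def, L2.inner_def, ← integral_add_compl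
    (measurableSet_Icc (a := -Real.pi) (b := Real.pi)) (L2.integrable_inner v h)]
  congr 1
  · rw [setIntegral_weightedMeasure _ _ measurableSet_Icc]
    refine integral_congr_ae ?_
    filter_upwards [hW.coeFn_toLp, lpMono_coeFn (bandMeasure_le_weightedMeasure hlam) v] with u h1 h2
    rw [h1, h2, RCLike.inner_apply, RCLike.inner_apply, weightMul, mul_assoc]
  · refine integral_congr_ae ?_
    filter_upwards [lpMono_coeFn (tailMeasure_le lam) v, lpMono_coeFn (tailMeasure_le lam) h]
      with u h1 h2
    rw [h1, h2]

/-- The distance on the band between `F` and the weighted solution of the normal equations. -/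
theorem norm_sub_weightMul_le {B : ℝ} (hB : 0 < B)
    {T : lp (fun _ : ℤ => ℂ) 2 →L[ℂ] Lp ℂ 2 bandMeasure} (hsurj : Function.Surjective T)
    (hlow : ∀ c, ‖c‖ ≤ B * ‖T c‖) {lam : ℝ} (hlam : 0 < lam)
    {S : lp (fun _ : ℤ => ℂ) 2 →L[ℂ] Lp ℂ 2 (weightedMeasure lam)}
    (hST : ∀ c, lpMono (bandMeasure_le_weightedMeasure hlam) (S c) = T c) {K : ℝ} (hK : 0 ≤ K)
    (htail : ∀ c, ‖lpMono (tailMeasure_le lam) (S c)‖ ^ 2 ≤ K ^ 2 * ‖c‖ ^ 2)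
    {F' : Lp ℂ 2 bandMeasure} {h : Lp ℂ 2 (weightedMeasure lam)}
    (hF' : ∀ d, inner ℂ (S d) h = inner ℂ (T d) F') (hW : MemLp (weightMul lam h) 2 bandMeasure) :
    ‖F' - hW.toLp _‖ ≤ K * B * ‖h‖ := by
  -- Duality with an extremal test vector: `T d` is the error itself.
  obtain ⟨d, hd⟩ := hsurj (F' - hW.toLp _)
  have h1 : inner ℂ (T d) (F' - hW.toLp _)
      = inner ℂ (lpMono (tailMeasure_le lam) (S d)) (lpMono (tailMeasure_le lam) h) := by
    rw [inner_sub_right, ← hF' d, inner_lpMono_eq hlam _ _ hW, hST]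
    ring
  have h2 : ‖lpMono (tailMeasure_le lam) (S d)‖ ≤ K * ‖d‖ := by
    refine (sq_le_sq₀ (norm_nonneg _) (by positivity)).1 ?_
    rw [mul_pow]
    exact htail d
  rw [← hd] at h1 ⊢
  have h3 : ‖T d‖ * ‖T d‖ ≤ ‖T d‖ * (K * B * ‖h‖) := by
    calc ‖T d‖ * ‖T d‖ = RCLike.re (inner ℂ (T d) (T d)) :=
          (inner_self_eq_norm_mul_norm (𝕜 := ℂ) _).symm
      _ ≤ ‖lpMono (tailMeasure_le lam) (S d)‖ * ‖lpMono (tailMeasure_le lam) h‖ := by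
          rw [h1]; exact re_inner_le_norm _ _
      _ ≤ (K * (B * ‖T d‖)) * ‖h‖ := by
          refine mul_le_mul (h2.trans (mul_le_mul_of_nonneg_left (hlow d) hK))
            (norm_lpMono_le _ _) (norm_nonneg _) (by positivity)
      _ = ‖T d‖ * (K * B * ‖h‖) := by ring
  rcases (norm_nonneg (T d)).eq_or_lt' with h0 | h0
  · rw [h0]; positivity
  · exact le_of_mul_le_mul_left h3 h0

/-- Pairing the series `S a` with `e_t` produces Gaussians times `weightMass`, while point
evaluation carries a factor `2π`; together they give the rescaling of `a`. -/
theorem hasSum_gaussian {x : ℤ → ℝ} {lam : ℝ} (hlam : 0 < lam)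
    {S : lp (fun _ : ℤ => ℂ) 2 →L[ℂ] Lp ℂ 2 (weightedMeasure lam)}
    (hS : ∀ c, HasSum (fun j => c j • weightedExponential hlam (x j)) (S c))
    (a : lp (fun _ : ℤ => ℂ) 2) (t : ℝ) :
    HasSum (fun j => a j * gaussian lam (t - x j))
      (angularFourierInv (weightMul lam (S ((2 * Real.pi / weightMass lam : ℂ) • a))) t) := by
  have hκ : (weightMass lam : ℂ) ≠ 0 := by exact_mod_cast (weightMass_pos hlam).ne'
  have hpi : (2 * Real.pi : ℂ) ≠ 0 := by simp
  have h1 : HasSum (fun j => inner ℂ (weightedExponential hlam t)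
      (a j • weightedExponential hlam (x j))) (inner ℂ (weightedExponential hlam t) (S a)) :=
    (hS a).mapL (innerSL ℂ (weightedExponential hlam t))
  have h2 := h1.mul_left (weightMass lam : ℂ)⁻¹
  have h3 := inner_weightedExponential hlam t (S ((2 * Real.pi / weightMass lam : ℂ) • a))
  rw [map_smul, inner_smul_right] at h3
  have h4 : (weightMass lam : ℂ)⁻¹ * inner ℂ (weightedExponential hlam t) (S a)
      = angularFourierInv (weightMul lam (S ((2 * Real.pi / weightMass lam : ℂ) • a))) t := by
    refine mul_left_cancel₀ hpi (Eq.trans ?_ (h3.trans ?_))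
    · rw [← mul_assoc, div_eq_mul_inv]
    · rw [map_smul]; rfl
  rw [h4] at h2
  have h5 : (fun j => a j * gaussian lam (t - x j)) = fun j => (weightMass lam : ℂ)⁻¹ *
      inner ℂ (weightedExponential hlam t) (a j • weightedExponential hlam (x j)) := by
    funext j
    rw [inner_smul_right, inner_weightedExponential_weightedExponential]
    field_simp
  rwa [h5]

/-- The interpolation equations are the normal equations of the weighted synthesis operator. -/
theorem isGaussianCoeff_iff {x : ℤ → ℝ} {F : ℝ → ℂ} (hF : MemLp F 2 volume)
    (hF' : MemLp F 2 bandMeasure) (h0 : ∀ u ∉ Set.Icc (-Real.pi) Real.pi, F u = 0) {lam : ℝ}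
    (hlam : 0 < lam) {S : lp (fun _ : ℤ => ℂ) 2 →L[ℂ] Lp ℂ 2 (weightedMeasure lam)}
    (hS : ∀ c, HasSum (fun j => c j • weightedExponential hlam (x j)) (S c))
    (a : lp (fun _ : ℤ => ℂ) 2) :
    IsGaussianCoeff lam x (angularFourierInv F) a ↔
      ∀ d, inner ℂ (S d) (S ((2 * Real.pi / weightMass lam : ℂ) • a))
        = inner ℂ (S d) ((memLp_weightDiv hF h0 hlam).toLp _) := by
  have hpi : (2 * Real.pi : ℂ) ≠ 0 := by simp
  set h := S ((2 * Real.pi / weightMass lam : ℂ) • a) with hh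
  have h1 : ∀ k, inner ℂ (weightedExponential hlam (x k)) h
      = inner ℂ (weightedExponential hlam (x k)) ((memLp_weightDiv hF h0 hlam).toLp _) ↔
      angularFourierInv (weightMul lam h) (x k) = angularFourierInv F (x k) := by
    intro k
    rw [inner_weightDiv hF hF' h0 hlam, lpMono_weightedExponential, inner_exponential _ hF' h0,
      inner_weightedExponential, mul_right_inj' hpi]
    rfl
  constructor
  · rintro ⟨-, h2⟩ d
    refine inner_synthesis_congr hS (fun k => (h1 k).2 ?_) d
    exact (hasSum_gaussian hlam hS a (x k)).unique (h2 k)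
  · intro h2
    refine ⟨lp_summable_sq a, fun k => ?_⟩
    rw [← (h1 k).1 (by simpa only [synthesis_single hS] using h2 (lp.single 2 k 1))]
    exact hasSum_gaussian hlam hS a (x k)

/-- Existence and uniqueness of the interpolation coefficients, and the spectral description of the
interpolant. -/
theorem gaussianInterpolant_spec {x : ℤ → ℝ} {B : ℝ} (hB : 0 < B)
    {T : lp (fun _ : ℤ => ℂ) 2 →L[ℂ] Lp ℂ 2 bandMeasure}
    (hfin : ∀ (s : Finset ℤ) (c : ℤ → ℂ),
      ‖∑ j ∈ s, c j • exponential (x j)‖ ^ 2 ≤ B ^ 2 * ∑ j ∈ s, ‖c j‖ ^ 2)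
    (hT : ∀ c, HasSum (fun j => c j • exponential (x j)) (T c)) (hsurj : Function.Surjective T)
    (hlow : ∀ c, ‖c‖ ≤ B * ‖T c‖) {F : ℝ → ℂ} (hF : MemLp F 2 volume)
    (hF' : MemLp F 2 bandMeasure) (h0 : ∀ u ∉ Set.Icc (-Real.pi) Real.pi, F u = 0) {lam : ℝ}
    (hlam : 0 < lam) :
    (∃! a, IsGaussianCoeff lam x (angularFourierInv F) a) ∧
    (∀ t, Summable fun j => gaussianCoeff lam x (angularFourierInv F) j * gaussian lam (t - x j)) ∧
    ∃ h : Lp ℂ 2 (weightedMeasure lam),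
      gaussianInterpolant lam x (angularFourierInv F) = angularFourierInv (weightMul lam h) ∧
      ENNReal.ofReal ‖h‖ ≤ eLpNorm (weightDiv lam F) 2 (weightedMeasure lam) ∧
      ∀ hW : MemLp (weightMul lam h) 2 bandMeasure, ‖hF'.toLp F - hW.toLp _‖
        ≤ Real.sqrt (max 1 lam * tailConst * B ^ 2) * B * ‖h‖ := by
  have ht := tailConst_nonneg
  obtain ⟨S, hS, hST, htail⟩ := exists_weighted_synthesis hfin hT hlam
  have hθ : (2 * Real.pi / weightMass lam : ℂ) ≠ 0 :=
    div_ne_zero (by simp) (by exact_mod_cast (weightMass_pos hlam).ne')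
  have hSlow : ∀ c, ‖c‖ ≤ B * ‖S c‖ := fun c =>
    (hlow c).trans (mul_le_mul_of_nonneg_left (hST c ▸ norm_lpMono_le _ _) hB.le)
  obtain ⟨b, hb, hbu⟩ := existsUnique_normal_equation S hB hSlow ((memLp_weightDiv hF h0 hlam).toLp _)
  have hiff := isGaussianCoeff_iff hF hF' h0 hlam hS
  have hex : ∃! a, IsGaussianCoeff lam x (angularFourierInv F) a := by
    refine ⟨((2 * Real.pi / weightMass lam : ℂ)⁻¹ • b : lp (fun _ : ℤ => ℂ) 2), ?_, fun a ha => ?_⟩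
    · refine (hiff _).2 ?_
      rw [smul_inv_smul₀ hθ]
      exact hb
    · set a' : lp (fun _ : ℤ => ℂ) 2 := ⟨a, memℓp_two_iff.2 ha.1⟩ with ha'
      have h1 := hbu _ ((hiff a').1 ha)
      have h2 : a' = (2 * Real.pi / weightMass lam : ℂ)⁻¹ • b := by rw [← h1, inv_smul_smul₀ hθ]
      exact congrArg (fun z : lp (fun _ : ℤ => ℂ) 2 => (z : ℤ → ℂ)) h2
  have hspec : IsGaussianCoeff lam x (angularFourierInv F)
      (gaussianCoeff lam x (angularFourierInv F)) := Classical.epsilon_spec hex.exists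
  set a : lp (fun _ : ℤ => ℂ) 2 := ⟨_, memℓp_two_iff.2 hspec.1⟩ with ha
  have hsum := hasSum_gaussian hlam hS a
  have hnormal := (hiff a).1 hspec
  refine ⟨hex, fun t => (hsum t).summable, S ((2 * Real.pi / weightMass lam : ℂ) • a),
    funext fun t => (hsum t).tsum_eq, ?_, fun hW => ?_⟩
  · rw [← ENNReal.ofReal_toReal (memLp_weightDiv hF h0 hlam).2.ne, ← Lp.norm_toLp _
      (memLp_weightDiv hF h0 hlam)]
    exact ENNReal.ofReal_le_ofReal (norm_le_of_normal_equation hnormal)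
  · refine norm_sub_weightMul_le hB hsurj hlow hlam hST (Real.sqrt_nonneg _) (fun c => ?_)
      (fun d => ?_) hW
    · rw [Real.sq_sqrt (by positivity)]
      exact htail c
    · rw [hnormal d, inner_weightDiv hF hF' h0 hlam, hST]

/-! ### Error bounds and the limit -/

section Error

variable {F : ℝ → ℂ} {lam C : ℝ}

theorem eLpNorm_sub_weightMul_le (hF' : MemLp F 2 bandMeasure)
    (h0 : ∀ u ∉ Set.Icc (-Real.pi) Real.pi, F u = 0) (hlam : 0 < lam) (hC : 0 ≤ C)
    {h : Lp ℂ 2 (weightedMeasure lam)} (hW : MemLp (weightMul lam h) 2 bandMeasure)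
    (hY : ‖hF'.toLp F - hW.toLp _‖ ≤ C * ‖h‖) :
    eLpNorm (F - weightMul lam h) 2 volume ≤ ENNReal.ofReal (C + 1) * ENNReal.ofReal ‖h‖ := by
  rw [← ENNReal.ofReal_mul (by positivity), ← ENNReal.pow_le_pow_left_iff two_ne_zero,
    eLpNorm_two_sq_eq_lintegral, ← lintegral_add_compl _ (measurableSet_Icc (a := -Real.pi) (b := Real.pi)),
    ← ENNReal.ofReal_pow (by positivity)]
  have h1 : ∫⁻ u in Set.Icc (-Real.pi) Real.pi, ‖(F - weightMul lam h) u‖ₑ ^ 2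
      ≤ ENNReal.ofReal ((C * ‖h‖) ^ 2) := by
    refine le_trans (le_of_eq ?_)
      (ENNReal.ofReal_le_ofReal (pow_le_pow_left₀ (norm_nonneg _) hY 2))
    rw [ofReal_norm_sq_eq_lintegral, ← MemLp.toLp_sub]
    refine lintegral_congr_ae ?_
    filter_upwards [(hF'.sub hW).coeFn_toLp] with u hu
    rw [hu]
  have h2 : ∫⁻ u in (Set.Icc (-Real.pi) Real.pi)ᶜ, ‖(F - weightMul lam h) u‖ₑ ^ 2
      ≤ ENNReal.ofReal (‖h‖ ^ 2) := by
    refine le_trans (le_of_eq ?_) (setLIntegral_compl_weightMul_sq_le hlam h)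
    refine setLIntegral_congr_fun measurableSet_Icc.compl fun u hu => ?_
    simp only [Pi.sub_apply, h0 u hu, zero_sub, enorm_neg]
  refine (add_le_add h1 h2).trans ?_
  rw [← ENNReal.ofReal_add (by positivity) (by positivity)]
  -- The two parts add up to `(C² + 1)‖h‖² ≤ ((C + 1)‖h‖)²`.
  refine ENNReal.ofReal_le_ofReal ?_
  nlinarith [mul_nonneg hC (sq_nonneg ‖h‖)]

theorem lintegral_sub_weightMul_le (hF' : MemLp F 2 bandMeasure)
    (h0 : ∀ u ∉ Set.Icc (-Real.pi) Real.pi, F u = 0) (hlam : 0 < lam) (hlam1 : lam ≤ 1)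
    (hC : 0 ≤ C) {h : Lp ℂ 2 (weightedMeasure lam)}
    (hW : MemLp (weightMul lam h) 2 bandMeasure)
    (hY : ‖hF'.toLp F - hW.toLp _‖ ≤ C * ‖h‖) :
    ∫⁻ u, ‖(F - weightMul lam h) u‖ₑ
      ≤ (ENNReal.ofReal C * bandMeasure Set.univ ^ (1 / 2 : ℝ)
        + weightedMeasure 1 Set.univ ^ (1 / 2 : ℝ)) * ENNReal.ofReal ‖h‖ := by
  rw [← lintegral_add_compl _ (measurableSet_Icc (a := -Real.pi) (b := Real.pi)), add_mul]
  refine add_le_add ?_ ?_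
  · rw [← eLpNorm_one_eq_lintegral_enorm]
    refine (eLpNorm_le_eLpNorm_mul_rpow_measure_univ (p := 1) (q := 2) (by norm_num)
      (hF'.sub hW).1).trans ?_
    rw [mul_right_comm, ← ENNReal.ofReal_mul hC]
    refine mul_le_mul' ?_ (by norm_num)
    refine le_trans (le_of_eq ?_) (ENNReal.ofReal_le_ofReal hY)
    rw [← MemLp.toLp_sub, ofReal_norm, Lp.enorm_def]
    exact (eLpNorm_congr_ae (hF'.sub hW).coeFn_toLp).symm
  · rw [mul_comm]
    refine le_trans (le_of_eq ?_) (setLIntegral_compl_weightMul_le hlam hlam1 h)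
    refine setLIntegral_congr_fun measurableSet_Icc.compl fun u hu => ?_
    simp only [Pi.sub_apply, h0 u hu, zero_sub, enorm_neg]

end Error

theorem angularFourierInv_sub {D E : ℝ → ℂ} (hD : Integrable D) (hE : Integrable E) (t : ℝ) :
    angularFourierInv (D - E) t = angularFourierInv D t - angularFourierInv E t := by
  have key : ∀ {G : ℝ → ℂ}, Integrable G →
      Integrable fun u : ℝ => Complex.exp (Complex.I * t * u) * G u := fun {G} hG => by
    refine hG.bdd_mul (c := 1) (Continuous.aestronglyMeasurable (by fun_prop)) (.of_forall fun u => ?_)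
    rw [show Complex.I * (t : ℂ) * (u : ℂ) = ((t * u : ℝ) : ℂ) * Complex.I by push_cast; ring,
      Complex.norm_exp_ofReal_mul_I]
  simp only [angularFourierInv, Pi.sub_apply, mul_sub]
  rw [integral_sub (key hD) (key hE), mul_sub]

theorem theoremT (x : ℤ → ℝ) (hx : IsRieszBasisSequence x) (f : ℝ → ℂ) (hf : f ∈ paleyWiener) :
    (∀ lam : ℝ, 0 < lam →
      (∃! a : ℤ → ℂ, IsGaussianCoeff lam x f a) ∧
      (∀ t : ℝ, Summable (fun j => gaussianCoeff lam x f j * gaussian lam (t - x j))) ∧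
      (∀ k : ℤ, gaussianInterpolant lam x f (x k) = f (x k)) ∧
      Continuous (gaussianInterpolant lam x f) ∧
      MemLp (gaussianInterpolant lam x f) 2 volume) ∧
    Tendsto (fun lam : ℝ => eLpNorm (fun t => f t - gaussianInterpolant lam x f t) 2 volume)
      (𝓝[>] 0) (𝓝 0) ∧
    TendstoUniformly (fun lam : ℝ => gaussianInterpolant lam x f) f (𝓝[>] 0) := by
  obtain ⟨F, hF, h0, rfl⟩ := exists_spectrum_of_mem_paleyWiener hf
  obtain ⟨B, T, hB, hfin, hT, hsurj, hlow⟩ := hx.rieszBasis.exists_synthesis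
  have hF' : MemLp F 2 bandMeasure := hF.mono_measure Measure.restrict_le_self
  have hF1 := integrable_of_memLp_two_of_eq_zero hF h0
  have spec := fun {lam : ℝ} (hlam : 0 < lam) =>
    gaussianInterpolant_spec hB hfin hT hsurj hlow hF hF' h0 hlam
  -- The `1` is the value of `max 1 lam` for `λ ≤ 1`, so `C` does not depend on `λ`.
  set C := Real.sqrt (1 * tailConst * B ^ 2) * B with hCdef
  have hC : 0 ≤ C := by positivity
  have htend := tendsto_eLpNorm_weightDiv hF h0
  have hsmall : ∀ᶠ lam : ℝ in 𝓝[>] 0, 0 < lam ∧ lam ≤ 1 :=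
    Filter.Eventually.and self_mem_nhdsWithin (mem_nhdsWithin_of_mem_nhds (Iic_mem_nhds one_pos))
  have herr : ∀ {lam : ℝ}, 0 < lam → lam ≤ 1 → ∃ D : ℝ → ℂ, Integrable D ∧ MemLp D 2 volume ∧
      (fun t => angularFourierInv F t - gaussianInterpolant lam x (angularFourierInv F) t)
        = angularFourierInv D ∧
      eLpNorm D 2 volume
        ≤ ENNReal.ofReal (C + 1) * eLpNorm (weightDiv lam F) 2 (weightedMeasure lam) ∧
      ∫⁻ u, ‖D u‖ₑ ≤ (ENNReal.ofReal C * bandMeasure Set.univ ^ (1 / 2 : ℝ)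
        + weightedMeasure 1 Set.univ ^ (1 / 2 : ℝ))
          * eLpNorm (weightDiv lam F) 2 (weightedMeasure lam) := by
    intro lam hlam hlam1
    obtain ⟨-, -, h, hI, hh, hY⟩ := spec hlam
    have hW := memLp_weightMul hlam h
    have hW1 := integrable_weightMul hlam h
    have hW' := hW.mono_measure (Measure.restrict_le_self : bandMeasure ≤ volume)
    have hY' := hY hW'
    rw [max_eq_left hlam1] at hY'
    refine ⟨F - weightMul lam h, hF1.sub hW1, hF.sub hW, ?_, ?_, ?_⟩
    · rw [hI]
      exact funext fun t => (angularFourierInv_sub hF1 hW1 t).symm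
    · exact (eLpNorm_sub_weightMul_le hF' h0 hlam hC hW' hY').trans (mul_le_mul_right hh _)
    · exact (lintegral_sub_weightMul_le hF' h0 hlam hlam1 hC hW' hY').trans (mul_le_mul_right hh _)
  refine ⟨fun lam hlam => ?_, ?_, ?_⟩
  · obtain ⟨hex, hsum, h, hI, -⟩ := spec hlam
    have hspec : IsGaussianCoeff lam x (angularFourierInv F)
      (gaussianCoeff lam x (angularFourierInv F)) := Classical.epsilon_spec hex.exists
    have hW := memLp_weightMul hlam h
    have hW1 := integrable_weightMul hlam h
    have hcont : Continuous (gaussianInterpolant lam x (angularFourierInv F)) :=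
      hI ▸ continuous_angularFourierInv hW1
    refine ⟨hex, hsum, fun k => (hspec.2 k).tsum_eq, hcont, hcont.aestronglyMeasurable, ?_⟩
    rw [hI]
    exact (eLpNorm_angularFourierInv_le hW1 hW).trans_lt hW.2
  · have h1 := ENNReal.Tendsto.const_mul (a := ENNReal.ofReal (C + 1)) htend
      (Or.inr ENNReal.ofReal_ne_top)
    rw [mul_zero] at h1
    refine tendsto_of_tendsto_of_tendsto_of_le_of_le' tendsto_const_nhds h1
      (.of_forall fun _ => zero_le) ?_
    filter_upwards [hsmall] with lam hlam
    obtain ⟨D, hD1, hD2, hD, hL2, -⟩ := herr hlam.1 hlam.2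
    rw [hD]
    exact (eLpNorm_angularFourierInv_le hD1 hD2).trans hL2
  · have := isFiniteMeasure_weightedMeasure one_pos
    have h1 := ENNReal.Tendsto.const_mul (a := ENNReal.ofReal C * bandMeasure Set.univ ^ (1 / 2 : ℝ)
        + weightedMeasure 1 Set.univ ^ (1 / 2 : ℝ)) htend
      (Or.inr (ENNReal.add_ne_top.2 ⟨ENNReal.mul_ne_top ENNReal.ofReal_ne_top
        (ENNReal.rpow_ne_top_of_nonneg (by norm_num) (measure_ne_top _ _)),
        ENNReal.rpow_ne_top_of_nonneg (by norm_num) (measure_ne_top _ _)⟩))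
    rw [mul_zero] at h1
    rw [Metric.tendstoUniformly_iff]
    intro ε hε
    filter_upwards [hsmall, h1.eventually_lt_const (ENNReal.ofReal_pos.2 hε)] with lam hlam hlt t
    obtain ⟨D, hD1, -, hD, -, hL1⟩ := herr hlam.1 hlam.2
    rw [dist_eq_norm, congrFun hD t, ← ENNReal.ofReal_lt_ofReal_iff hε]
    refine lt_of_le_of_lt (ENNReal.ofReal_le_ofReal (norm_angularFourierInv_le D t)) ?_
    rw [ofReal_integral_norm_eq_lintegral_enorm hD1]
    exact hL1.trans_lt hlt

end
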